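/- Let $\mathcal F^2$ be the Fock space, that is, the Hilbert space of entire functions $f$ with $\|f\|^2=\frac1\pi\int_{\mathbb C}|f(z)|^2e^{-|z|^2}\,dV(z)<\infty$, where $dV$ is Lebesgue measure on $\mathbb C$. For entire functions $\psi,\varphi$ with $\psi\not\equiv 0$, the maximal weighted composition operator $W_{\psi,\varphi,\max}$ is defined by $$\mathrm{dom}(W_{\psi,\varphi,\max})=\{f\in\mathcal F^2:\ \psi\cdot (f\circ\varphi)\in\mathcal F^2\},\qquad W_{\psi,\varphi,\max}f=\psi\cdot (f\circ\varphi).$$ An unbounded weighted composition operator $W_{\psi,\varphi}$ induced by $\psi,\varphi$ is any restriction of $W_{\psi,\varphi,\max}$ to a linear subspace of $\mathrm{dom}(W_{\psi,\varphi,\max})$ ("unbounded" means "not necessarily bounded"). A linear operator $T$ in a Hilbert space is called cohyponormal if it is closed and densely defined, $\mathrm{dom}(T^*)\subseteq\mathrm{dom}(T)$, and $\|T^*x\|\ge\|Tx\|$ for all $x\in\mathrm{dom}(T^*)$. **Theorem.** Let $W_{\psi,\varphi}$ be an unbounded weighted composition operator on $\mathcal F^2$ induced by entire functions $\psi,\varphi$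 with $\psi\not\equiv 0$. Then $W_{\psi,\varphi}$ is cohyponormal if and only if both of the following conditions hold. 1. $W_{\psi,\varphi}=W_{\psi,\varphi,\max}$ (equality of operators, including their domains). 2. One of the following cases occurs, for some complex constants $A,B,C,D$: - $\varphi(z)=Az+B$ with $A\neq 1$, and $\psi(z)=Ce^{Dz}$, where $D=\overline{B}(1-A)(1-\overline{A})^{-1}$; - $\varphi(z)=z+B$, and $\psi(z)=Ce^{Dz}$, where $|B|\ge|D|$. -/

import Mathlib

open MeasureTheory Filter Topology ComplexConjugate
open scoped ENNReal InnerProductSpace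

namespace FockWCO

/-- The Gaussian measure `(1/π) e^{-|z|²} dV(z)` on `ℂ`, where `dV` is Lebesgue measure. -/
noncomputable def gaussian : Measure ℂ :=
  (volume : Measure ℂ).withDensity
    (fun z => ENNReal.ofReal (1 / Real.pi * Real.exp (-‖z‖ ^ 2)))

/-- The entire functions that are square integrable for the Gaussian measure, as a linear
subspace of the space of all functions `ℂ → ℂ`. -/
def fockSubmodule : Submodule ℂ (ℂ → ℂ) where
  carrier := {f | Differentiable ℂ f ∧ MemLp f 2 gaussian}
  add_mem' := fun hf hg => ⟨hf.1.add hg.1, hf.2.add hg.2⟩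
  zero_mem' := ⟨differentiable_const 0, MemLp.zero⟩
  smul_mem' := fun c _ hf => ⟨hf.1.const_smul c, hf.2.const_smul c⟩

/-- The Fock space `F²`. It is a type synonym of `fockSubmodule`, so that it carries the Hilbert
space topology below and not the topology of pointwise convergence. -/
def Fock : Type := fockSubmodule

namespace Fock

noncomputable instance : AddCommGroup Fock := inferInstanceAs (AddCommGroup fockSubmodule)

noncomputable instance : Module ℂ Fock := inferInstanceAs (Module ℂ fockSubmodule)

/-- The entire function underlying an element of the Fock space. -/
@[coe] def toFun (f : Fock) : ℂ → ℂ := Subtype.val (p := (· ∈ fockSubmodule)) f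

instance : CoeFun Fock (fun _ => ℂ → ℂ) := ⟨toFun⟩

@[ext] theorem ext {f g : Fock} (h : ∀ z, f z = g z) : f = g := Subtype.ext (funext h)

/-- The element of the Fock space given by a function in `fockSubmodule`. -/
def mk (f : ℂ → ℂ) (hf : f ∈ fockSubmodule) : Fock := ⟨f, hf⟩

theorem mk_apply (f : ℂ → ℂ) (hf : f ∈ fockSubmodule) (z : ℂ) : mk f hf z = f z := rfl

theorem mem (f : Fock) : (f : ℂ → ℂ) ∈ fockSubmodule := f.2

theorem differentiable (f : Fock) : Differentiable ℂ f := f.2.1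

theorem memLp (f : Fock) : MemLp f 2 gaussian := f.2.2

theorem add_apply (f g : Fock) (z : ℂ) : (f + g) z = f z + g z := rfl

theorem sub_apply (f g : Fock) (z : ℂ) : (f - g) z = f z - g z := rfl

theorem smul_apply (c : ℂ) (f : Fock) (z : ℂ) : (c • f) z = c * f z := rfl

theorem zero_apply (z : ℂ) : (0 : Fock) z = 0 := rfl

/-- The inner product integrand is integrable. -/
theorem integrable_mul (f g : Fock) : Integrable (fun z => conj (f z) * g z) gaussian :=
  MemLp.integrable_mul (p := 2) (q := 2) f.memLp.star g.memLp

theorem volume_ac : (volume : Measure ℂ) ≪ gaussian := by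
  refine withDensity_absolutelyContinuous' (by fun_prop) (ae_of_all _ fun z => ?_)
  have : 0 < 1 / Real.pi * Real.exp (-‖z‖ ^ 2) := by positivity
  simpa using this

theorem gaussian_ac : gaussian ≪ (volume : Measure ℂ) := withDensity_absolutelyContinuous _ _

/-- The inner product of the Fock space, `∫ f̄ g` against the Gaussian measure, in the convention of Mathlib: conjugate linear in the
first argument. -/
noncomputable abbrev core : InnerProductSpace.Core ℂ Fock where
  inner f g := ∫ z, conj (f z) * g z ∂gaussian
  conj_inner_symm f g := by
    rw [← integral_conj]
    refine integral_congr_ae (ae_of_all _ fun z => ?_)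
    simp [mul_comm]
  re_inner_nonneg f := by
    have h : ∀ z, conj (f z) * f z = ((‖f z‖ ^ 2 : ℝ) : ℂ) := fun z => by
      rw [mul_comm, Complex.mul_conj, Complex.normSq_eq_norm_sq]
    simp only [h]
    have h2 : ∫ z, ((‖f z‖ ^ 2 : ℝ) : ℂ) ∂gaussian = ((∫ z, ‖f z‖ ^ 2 ∂gaussian : ℝ) : ℂ) :=
      integral_ofReal
    rw [h2]
    exact integral_nonneg (μ := gaussian) (fun z => sq_nonneg ‖f z‖)
  add_left f g h := by
    rw [← integral_add (integrable_mul f h) (integrable_mul g h)]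
    refine integral_congr_ae (ae_of_all _ fun z => ?_)
    simp [add_apply, add_mul]
  smul_left f g r := by
    rw [← integral_const_mul]
    refine integral_congr_ae (ae_of_all _ fun z => ?_)
    simp [smul_apply, mul_assoc]
  definite f hf := by
    have h : ∀ z, conj (f z) * f z = ((‖f z‖ ^ 2 : ℝ) : ℂ) := fun z => by
      rw [mul_comm, Complex.mul_conj, Complex.normSq_eq_norm_sq]
    have hint : Integrable (fun z => ‖f z‖ ^ 2) gaussian := by
      simpa using f.memLp.integrable_norm_pow (p := 2) two_ne_zero
    have hf' : ∫ z, ‖f z‖ ^ 2 ∂gaussian = 0 := by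
      have : ∫ z, conj (f z) * f z ∂gaussian = 0 := hf
      simp only [h] at this
      have h2 : ∫ z, ((‖f z‖ ^ 2 : ℝ) : ℂ) ∂gaussian = ((∫ z, ‖f z‖ ^ 2 ∂gaussian : ℝ) : ℂ) :=
        integral_ofReal
      rw [h2] at this
      exact_mod_cast this
    rw [integral_eq_zero_iff_of_nonneg (fun z => sq_nonneg _) hint] at hf'
    have hae : (f : ℂ → ℂ) =ᵐ[volume] (fun _ => (0 : ℂ)) := by
      filter_upwards [volume_ac.ae_eq hf'] with z hz
      simpa using hz
    have := Continuous.ae_eq_iff_eq volume f.differentiable.continuous continuous_const |>.1 hae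
    exact ext fun z => congrFun this z

noncomputable instance : NormedAddCommGroup Fock :=
  InnerProductSpace.Core.toNormedAddCommGroup (cd := core)

noncomputable instance : InnerProductSpace ℂ Fock := InnerProductSpace.ofCore core.toCore

theorem inner_def (f g : Fock) : ⟪f, g⟫_ℂ = ∫ z, conj (f z) * g z ∂gaussian := rfl

theorem norm_sq_eq (f : Fock) : ‖f‖ ^ 2 = ∫ z, ‖f z‖ ^ 2 ∂gaussian := by
  have h : ∀ z, conj (f z) * f z = ((‖f z‖ ^ 2 : ℝ) : ℂ) := fun z => by
    rw [mul_comm, Complex.mul_conj, Complex.normSq_eq_norm_sq]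
  rw [@norm_sq_eq_re_inner ℂ, inner_def]
  simp only [h]
  have h2 : ∫ z, ((‖f z‖ ^ 2 : ℝ) : ℂ) ∂gaussian = ((∫ z, ‖f z‖ ^ 2 ∂gaussian : ℝ) : ℂ) :=
    integral_ofReal
  rw [h2]
  rfl

/-! The rest of this section shows that the Fock space is complete. -/

/-- The class in `L²` of an element of the Fock space. -/
noncomputable def toL2 (f : Fock) : Lp ℂ 2 gaussian := f.memLp.toLp f

theorem norm_toL2 (f : Fock) : ‖toL2 f‖ = ‖f‖ := by
  have h : ‖toL2 f‖ ^ 2 = ‖f‖ ^ 2 := by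
    rw [@norm_sq_eq_re_inner ℂ, @norm_sq_eq_re_inner ℂ, inner_def, L2.inner_def]
    congr 1
    refine integral_congr_ae ?_
    filter_upwards [f.memLp.coeFn_toLp] with z hz
    simp only [toL2, hz, RCLike.inner_apply]
    ring
  exact (sq_eq_sq₀ (norm_nonneg _) (norm_nonneg _)).1 h

theorem toL2_sub (f g : Fock) : toL2 (f - g) = toL2 f - toL2 g := rfl

/-- The area form of the sub-mean value property, up to the value of the constant. -/
theorem sub_mean (g : ℂ → ℂ) (hg : Differentiable ℂ g) (z : ℂ) :
    ENNReal.ofReal ‖g z‖ ≤ ∫⁻ w in Metric.ball z 1, ENNReal.ofReal ‖g w‖ := by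
  have hcirc : ∀ r : ℝ, ENNReal.ofReal (2 * Real.pi * ‖g z‖) ≤
      ∫⁻ θ in Set.Ioo (-Real.pi) Real.pi,
        ENNReal.ofReal ‖g (z + r * Complex.exp (θ * Complex.I))‖ := by
    intro r
    have hper : Function.Periodic (fun θ : ℝ => g (circleMap z r θ)) (2 * Real.pi) := fun θ => by
      simp [periodic_circleMap z r θ]
    have hcont : Continuous (fun θ : ℝ => g (circleMap z r θ)) :=
      hg.continuous.comp (continuous_circleMap z r)
    have havg : Real.circleAverage g z r = g z :=
      (hg.diffContOnCl (s := Metric.ball z |r|)).circleAverage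
    have h1 : ∫ θ in (-Real.pi)..Real.pi, g (circleMap z r θ) = (2 * Real.pi) * g z := by
      have h2 := hper.intervalIntegral_add_eq (-Real.pi) 0
      rw [show -Real.pi + 2 * Real.pi = Real.pi by ring, zero_add] at h2
      rw [h2, ← havg, Real.circleAverage_def]
      have : (Real.pi : ℂ) ≠ 0 := by exact_mod_cast Real.pi_ne_zero
      rw [Complex.real_smul]
      push_cast
      field_simp
    have h3 : 2 * Real.pi * ‖g z‖ ≤ ∫ θ in (-Real.pi)..Real.pi, ‖g (circleMap z r θ)‖ := by
      have h4 := intervalIntegral.norm_integral_le_integral_norm (μ := volume)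
        (f := fun θ => g (circleMap z r θ)) (show -Real.pi ≤ Real.pi by linarith [Real.pi_pos])
      rw [h1] at h4
      simpa [abs_of_pos Real.pi_pos] using h4
    refine (ENNReal.ofReal_le_ofReal h3).trans ?_
    rw [intervalIntegral.integral_of_le (by linarith [Real.pi_pos]),
      integral_Ioc_eq_integral_Ioo, ofReal_integral_eq_lintegral_ofReal]
    · exact le_of_eq rfl
    · exact (hcont.norm.integrableOn_Icc (a := -Real.pi) (b := Real.pi)).mono_set
        Set.Ioo_subset_Icc_self
    · exact ae_of_all _ fun _ => norm_nonneg _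
  set F : ℂ → ℝ≥0∞ := (Metric.ball (0 : ℂ) 1).indicator (fun w => ENNReal.ofReal ‖g (z + w)‖)
    with hF
  have hshift : ∫⁻ w in Metric.ball z 1, ENNReal.ofReal ‖g w‖ = ∫⁻ w, F w := by
    rw [← lintegral_indicator Metric.isOpen_ball.measurableSet,
      ← lintegral_add_left_eq_self _ z]
    refine lintegral_congr fun w => ?_
    simp [hF, Set.indicator]
  rw [hshift, ← Complex.lintegral_comp_polarCoord_symm]
  have hsub : Set.Ioo (0 : ℝ) 1 ×ˢ Set.Ioo (-Real.pi) Real.pi ⊆ polarCoord.target := by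
    rw [polarCoord_target]
    exact Set.prod_mono (fun x hx => hx.1) subset_rfl
  refine le_trans ?_ (lintegral_mono_set hsub)
  have hval : ∀ p ∈ Set.Ioo (0 : ℝ) 1 ×ˢ Set.Ioo (-Real.pi) Real.pi,
      ENNReal.ofReal p.1 • F (Complex.polarCoord.symm p) =
        ENNReal.ofReal p.1 * ENNReal.ofReal ‖g (z + p.1 * Complex.exp (p.2 * Complex.I))‖ := by
    rintro ⟨r, θ⟩ ⟨hr, -⟩
    have hpol : Complex.polarCoord.symm (r, θ) = r * Complex.exp (θ * Complex.I) := by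
      rw [Complex.polarCoord_symm_apply, Complex.exp_mul_I]
      simp
    have hmem : Complex.polarCoord.symm (r, θ) ∈ Metric.ball (0 : ℂ) 1 := by
      rw [hpol, mem_ball_zero_iff, norm_mul, Complex.norm_exp_ofReal_mul_I]
      simpa [abs_of_pos hr.1] using hr.2
    rw [hF, Set.indicator_of_mem hmem, hpol, smul_eq_mul]
  rw [setLIntegral_congr_fun (measurableSet_Ioo.prod measurableSet_Ioo) hval,
    Measure.volume_eq_prod, ← Measure.prod_restrict, lintegral_prod]
  swap
  · have hc := hg.continuous
    have h1 : Measurable fun x : ℝ × ℝ => ENNReal.ofReal x.1 := by fun_prop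
    have h2 : Continuous fun x : ℝ × ℝ => ‖g (z + x.1 * Complex.exp (x.2 * Complex.I))‖ := by
      fun_prop
    exact (h1.mul h2.measurable.ennreal_ofReal).aemeasurable
  calc ENNReal.ofReal ‖g z‖
      ≤ ENNReal.ofReal (1 / 2) * ENNReal.ofReal (1 / 2) *
          ENNReal.ofReal (2 * Real.pi * ‖g z‖) := by
        rw [← ENNReal.ofReal_mul (by norm_num), ← ENNReal.ofReal_mul (by norm_num)]
        refine ENNReal.ofReal_le_ofReal ?_
        nlinarith [Real.pi_gt_three, norm_nonneg (g z)]
    _ = ∫⁻ r in Set.Ioo (1 / 2 : ℝ) 1,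
          ENNReal.ofReal (1 / 2) * ENNReal.ofReal (2 * Real.pi * ‖g z‖) := by
        rw [setLIntegral_const, Real.volume_Ioo, mul_right_comm]
        norm_num
    _ ≤ ∫⁻ r in Set.Ioo (1 / 2 : ℝ) 1, ∫⁻ θ in Set.Ioo (-Real.pi) Real.pi, ENNReal.ofReal r *
          ENNReal.ofReal ‖g (z + r * Complex.exp (θ * Complex.I))‖ := by
        refine setLIntegral_mono' measurableSet_Ioo fun r hr => ?_
        rw [lintegral_const_mul' _ _ ENNReal.ofReal_ne_top]
        exact mul_le_mul' (ENNReal.ofReal_le_ofReal hr.1.le) (hcirc r)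
    _ ≤ _ := lintegral_mono_set (Set.Ioo_subset_Ioo_left (by norm_num))

/-- Point evaluations are bounded on the Fock space, uniformly on bounded sets. -/
theorem norm_apply_le (R : ℝ) : ∃ K : ℝ, 0 ≤ K ∧ ∀ f : Fock, ∀ z : ℂ, ‖z‖ ≤ R →
    ‖f z‖ ≤ K * ‖f‖ := by
  set c : ℝ := 1 / Real.pi * Real.exp (-(R + 1) ^ 2) with hc
  have hc0 : 0 < c := by positivity
  refine ⟨√(c⁻¹), Real.sqrt_nonneg _, fun f z hz => ?_⟩
  have hmem := f.differentiable
  have h1 := sub_mean (fun w => f w ^ 2) (hmem.pow 2) z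
  have h2 : ENNReal.ofReal c * ENNReal.ofReal ‖f z ^ 2‖ ≤ ENNReal.ofReal (‖f‖ ^ 2) := by
    calc ENNReal.ofReal c * ENNReal.ofReal ‖f z ^ 2‖
        ≤ ENNReal.ofReal c * ∫⁻ w in Metric.ball z 1, ENNReal.ofReal ‖f w ^ 2‖ := by gcongr
      _ = ∫⁻ w in Metric.ball z 1, ENNReal.ofReal c * ENNReal.ofReal ‖f w ^ 2‖ := by
          rw [lintegral_const_mul' _ _ ENNReal.ofReal_ne_top]
      _ ≤ ∫⁻ w in Metric.ball z 1, ENNReal.ofReal (1 / Real.pi * Real.exp (-‖w‖ ^ 2)) *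
            ENNReal.ofReal ‖f w ^ 2‖ := by
          refine setLIntegral_mono' Metric.isOpen_ball.measurableSet fun w hw => ?_
          have hw1 : ‖w‖ ≤ R + 1 := by
            have h3 : ‖w - z‖ < 1 := by simpa [dist_eq_norm] using hw
            have h4 := norm_sub_norm_le w z
            linarith
          gcongr
          rw [hc]
          gcongr
      _ ≤ ∫⁻ w, ENNReal.ofReal (1 / Real.pi * Real.exp (-‖w‖ ^ 2)) *
            ENNReal.ofReal ‖f w ^ 2‖ := setLIntegral_le_lintegral _ _
      _ = ∫⁻ w, ENNReal.ofReal ‖f w ^ 2‖ ∂gaussian := by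
          have hcont := hmem.continuous
          rw [gaussian, lintegral_withDensity_eq_lintegral_mul _ (by fun_prop) (by fun_prop)]
          rfl
      _ = ENNReal.ofReal (‖f‖ ^ 2) := by
          rw [norm_sq_eq, ofReal_integral_eq_lintegral_ofReal]
          · simp
          · simpa using f.memLp.integrable_norm_pow (p := 2) two_ne_zero
          · exact ae_of_all _ fun _ => by positivity
  rw [← ENNReal.ofReal_mul hc0.le, ENNReal.ofReal_le_ofReal_iff (by positivity), norm_pow] at h2
  rw [← Real.sqrt_sq (norm_nonneg f), ← Real.sqrt_mul (by positivity)]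
  refine Real.le_sqrt_of_sq_le ?_
  rw [inv_mul_eq_div, le_div_iff₀ hc0, mul_comm]
  exact h2

instance : CompleteSpace Fock := by
  refine Metric.complete_of_cauchySeq_tendsto fun u hu => ?_
  have hdist : ∀ f g : Fock, dist (toL2 f) (toL2 g) = dist f g := fun f g => by
    rw [dist_eq_norm, dist_eq_norm, ← toL2_sub, norm_toL2]
  have hL : CauchySeq (fun n => toL2 (u n)) := by
    rw [Metric.cauchySeq_iff] at hu ⊢
    simpa only [hdist] using hu
  obtain ⟨G, hG⟩ := cauchySeq_tendsto_of_complete hL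
  have hball : ∀ R : ℝ, UniformCauchySeqOn (fun n z => u n z) atTop (Metric.closedBall 0 R) := by
    intro R
    obtain ⟨K, hK, hb⟩ := norm_apply_le R
    rw [Metric.uniformCauchySeqOn_iff]
    intro ε hε
    rw [Metric.cauchySeq_iff] at hu
    obtain ⟨N, hN⟩ := hu (ε / (K + 1)) (by positivity)
    refine ⟨N, fun m hm n hn z hz => ?_⟩
    have h1 := hN m hm n hn
    rw [dist_eq_norm] at h1 ⊢
    have h2 := hb (u m - u n) z (by simpa using hz)
    rw [sub_apply] at h2
    rw [lt_div_iff₀ (by positivity)] at h1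
    nlinarith [norm_nonneg (u m - u n)]
  have hpt : ∀ z, ∃ y, Tendsto (fun n => u n z) atTop (𝓝 y) := fun z =>
    cauchySeq_tendsto_of_complete
      ((hball ‖z‖).cauchySeq (x := z) (by simp))
  choose F hF using hpt
  have hloc : TendstoLocallyUniformlyOn (fun n z => u n z) F atTop Set.univ := by
    rw [tendstoLocallyUniformlyOn_iff_forall_isCompact isOpen_univ]
    intro S _ hS
    obtain ⟨R, hR⟩ := hS.isBounded.subset_closedBall 0
    exact ((hball R).tendstoUniformlyOn_of_tendsto fun z _ => hF z).mono hR
  have hFd : Differentiable ℂ F := by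
    rw [← differentiableOn_univ]
    exact hloc.differentiableOn
      (Eventually.of_forall fun n => (u n).differentiable.differentiableOn) isOpen_univ
  have hFG : F =ᵐ[gaussian] G := by
    obtain ⟨ns, hns, hae⟩ := (tendstoInMeasure_of_tendsto_Lp hG).exists_seq_tendsto_ae
    have hall : ∀ᵐ z ∂gaussian, ∀ n, (toL2 (u n)) z = u n z :=
      ae_all_iff.2 fun n => (u n).memLp.coeFn_toLp
    filter_upwards [hae, hall] with z h1 h2
    simp only [h2] at h1
    exact tendsto_nhds_unique ((hF z).comp hns.tendsto_atTop) h1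
  have hFm : MemLp F 2 gaussian := (memLp_congr_ae hFG).2 (Lp.memLp G)
  refine ⟨mk F ⟨hFd, hFm⟩, ?_⟩
  have hFL : toL2 (mk F ⟨hFd, hFm⟩) = G := Lp.ext (hFm.coeFn_toLp.trans hFG)
  rw [tendsto_iff_dist_tendsto_zero] at hG ⊢
  simpa only [← hFL, hdist] using hG

end Fock

/-- The formal weighted composition expression `E(ψ,φ) f = ψ · (f ∘ φ)`. -/
def expr (ψ φ f : ℂ → ℂ) : ℂ → ℂ := fun z => ψ z * f (φ z)

/-- The maximal weighted composition operator `W_{ψ,φ,max}` on the Fock space: its domain consists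
of all `f` in the Fock space for which `E(ψ,φ) f` is in the Fock space. -/
noncomputable def maxOp (ψ φ : ℂ → ℂ) : Fock →ₗ.[ℂ] Fock where
  domain :=
    { carrier := {f | expr ψ φ f ∈ fockSubmodule}
      add_mem' := fun {f g} hf hg => by
        have h : expr ψ φ (f + g : Fock) = expr ψ φ f + expr ψ φ g := by
          funext z; simp [expr, Fock.add_apply, mul_add]
        show expr ψ φ (f + g : Fock) ∈ fockSubmodule
        rw [h]; exact fockSubmodule.add_mem hf hg
      zero_mem' := by
        have h : expr ψ φ (0 : Fock) = 0 := by
          funext z; simp [expr, Fock.zero_apply]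
        show expr ψ φ (0 : Fock) ∈ fockSubmodule
        rw [h]; exact fockSubmodule.zero_mem
      smul_mem' := fun c f hf => by
        have h : expr ψ φ (c • f : Fock) = c • expr ψ φ f := by
          funext z; simp [expr, Fock.smul_apply, mul_left_comm]
        show expr ψ φ (c • f : Fock) ∈ fockSubmodule
        rw [h]; exact fockSubmodule.smul_mem c hf }
  toFun :=
    { toFun := fun f => Fock.mk (expr ψ φ f.1) f.2
      map_add' := fun f g => Fock.ext fun z => mul_add (ψ z) (f.1 (φ z)) (g.1 (φ z))
      map_smul' := fun c f => Fock.ext fun z => mul_left_comm (ψ z) c (f.1 (φ z)) }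

/-- A linear operator `W` is an (unbounded) weighted composition operator with symbols `ψ`, `φ`
if it is a restriction of the maximal operator: `W ⪯ W_{ψ,φ,max}`. -/
def IsWeightedComp (ψ φ : ℂ → ℂ) (W : Fock →ₗ.[ℂ] Fock) : Prop := W ≤ maxOp ψ φ

open scoped LinearPMap in
/-- A linear operator `T` in a Hilbert space is cohyponormal if it is closed and densely defined,
`dom T* ⊆ dom T`, and `‖T* x‖ ≥ ‖T x‖` for all `x ∈ dom T*`. -/
structure IsCohyponormal {H : Type*} [NormedAddCommGroup H] [InnerProductSpace ℂ H]
    [CompleteSpace H] (T : H →ₗ.[ℂ] H) : Prop where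
  dense : Dense (T.domain : Set H)
  closed : T.IsClosed
  domain_le : T†.domain ≤ T.domain
  norm_le : ∀ x : T†.domain, ‖T ⟨x, domain_le x.2⟩‖ ≤ ‖T† x‖

end FockWCO

/-! Everything is tested on the reproducing kernels `kernel w`, whose span is dense.

Necessity of the symbol conditions: `W†` sends the kernel at `w` to `conj (ψ w)` times the kernel at
`φ w`. Cohyponormality and the pointwise bound on Fock functions therefore give a two-variable
inequality between `ψ` and `φ` (`IsWeightedComp.norm_kernel_le`). It prevents `ψ` from vanishing, so
`ψ = exp h`, and by Borel–Carathéodory `h` and `φ` are polynomials of degree at most two. Comparing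
coefficients makes `φ` affine (`quadratic_symbols`). The substitution `z = conj A * w + δ` then
cancels every `‖w‖²` term and leaves the real part of a polynomial in `w` bounded above, hence
constant (`admissible_of_kernel_inequality`).

Sufficiency: the adjoint of `T = expOp A B C D` is contained in the operator `S` with the adjoint
symbols. A rigid motion of the plane carries the integrand of `‖T f‖²` to `exp c` times that of `‖S
f‖²`, with `c ≤ 0` exactly under the stated conditions on the symbols
(`Admissible.exists_comparison`). So `T` and `S` have the same domain and `‖T f‖ ≤ ‖S f‖`.

Maximality: `T` and `S` are formally adjoint (`Admissible.isAdjointPair`). Hence for `W ≤ T` one has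
`dom T = dom S ⊆ dom W†`, and cohyponormality of `W` adds `dom W† ⊆ dom W`. -/

namespace FockWCO

/-! ### Gaussian integrals, growth and the mean value property -/

theorem integrable_gaussian_iff {E : Type*} [NormedAddCommGroup E] [NormedSpace ℝ E] {g : ℂ → E} :
    Integrable g gaussian ↔ Integrable (fun z => Real.exp (-‖z‖ ^ 2) • g z) := by
  have hpos : ∀ z : ℂ, 0 ≤ 1 / Real.pi * Real.exp (-‖z‖ ^ 2) := fun z => by positivity
  rw [gaussian, integrable_withDensity_iff_integrable_smul' (by fun_prop)
    (ae_of_all _ fun z => ENNReal.ofReal_lt_top)]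
  simp only [ENNReal.toReal_ofReal (hpos _), mul_smul]
  exact integrable_smul_iff (by positivity) _

theorem integral_gaussian {E : Type*} [NormedAddCommGroup E] [NormedSpace ℝ E] (g : ℂ → E) :
    ∫ z, g z ∂gaussian = (1 / Real.pi : ℝ) • ∫ z, Real.exp (-‖z‖ ^ 2) • g z := by
  have hpos : ∀ z : ℂ, 0 ≤ 1 / Real.pi * Real.exp (-‖z‖ ^ 2) := fun z => by positivity
  rw [gaussian, integral_withDensity_eq_integral_toReal_smul (by fun_prop)
    (ae_of_all _ fun z => ENNReal.ofReal_lt_top)]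
  simp only [ENNReal.toReal_ofReal (hpos _), mul_smul]
  rw [integral_smul]

theorem integrable_exp_neg_mul_sq {b : ℝ} (hb : 0 < b) :
    Integrable (fun z : ℂ => Real.exp (-b * ‖z‖ ^ 2)) := by
  have h := (GaussianFourier.integrable_cexp_neg_mul_sq_norm_add (V := ℂ) (b := (b : ℂ))
    (by simpa using hb) 0 0).norm
  refine h.congr (ae_of_all _ fun z => ?_)
  simp only [Complex.norm_exp]
  congr 1
  have : (-(b : ℂ) * (‖z‖ : ℂ) ^ 2 + 0 * ((inner ℝ (0 : ℂ) z : ℝ) : ℂ)) =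
    ((-b * ‖z‖ ^ 2 : ℝ) : ℂ) := by push_cast; ring
  rw [this, Complex.ofReal_re]

instance : IsProbabilityMeasure gaussian := by
  constructor
  have hi : Integrable (fun _ : ℂ => (1 : ℝ)) gaussian := by
    rw [integrable_gaussian_iff]
    simpa using integrable_exp_neg_mul_sq one_pos
  have h : ∫ _ : ℂ, (1 : ℝ) ∂gaussian = 1 := by
    rw [integral_gaussian]
    have := GaussianFourier.integral_rexp_neg_mul_sq_norm (V := ℂ) one_pos
    simp only [Complex.finrank_real_complex, neg_mul, one_mul] at this
    simp [this, Real.pi_ne_zero]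
  have hfin : IsFiniteMeasure gaussian := by
    simpa using integrable_const_iff.1 hi
  rw [integral_const, smul_eq_mul, mul_one, measureReal_def] at h
  rw [← ENNReal.ofReal_toReal (measure_ne_top gaussian Set.univ), h, ENNReal.ofReal_one]

/-- The weight `|f|² e^{-|z|²}` whose integral is, up to the factor `π`, the norm of the Fock
space. -/
noncomputable def wt (f : ℂ → ℂ) (z : ℂ) : ℝ := ‖f z‖ ^ 2 * Real.exp (-‖z‖ ^ 2)

theorem wt_nonneg (f : ℂ → ℂ) (z : ℂ) : 0 ≤ wt f z := by unfold wt; positivity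

theorem continuous_wt {f : ℂ → ℂ} (hf : Continuous f) : Continuous (wt f) := by
  unfold wt; fun_prop

theorem mem_fockSubmodule_iff {f : ℂ → ℂ} (hf : Differentiable ℂ f) :
    f ∈ fockSubmodule ↔ Integrable (wt f) := by
  have h : f ∈ fockSubmodule ↔ MemLp f 2 gaussian := ⟨fun h => h.2, fun h => ⟨hf, h⟩⟩
  rw [h, memLp_two_iff_integrable_sq_norm hf.continuous.aestronglyMeasurable,
    integrable_gaussian_iff]
  simp only [smul_eq_mul, mul_comm]
  rfl

theorem Fock.integrable_wt (f : Fock) : Integrable (wt f) :=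
  (mem_fockSubmodule_iff f.differentiable).1 f.mem

theorem Fock.norm_sq_eq_integral_wt (f : Fock) : ‖f‖ ^ 2 = 1 / Real.pi * ∫ z, wt f z := by
  rw [Fock.norm_sq_eq, integral_gaussian, smul_eq_mul]
  simp only [smul_eq_mul, mul_comm, wt]

theorem mem_fockSubmodule_of_growth {f : ℂ → ℂ} (hf : Differentiable ℂ f) {M a k : ℝ}
    (ha : a < 1 / 2) (h : ∀ z, ‖f z‖ ≤ M * Real.exp (a * ‖z‖ ^ 2 + k * ‖z‖)) :
    f ∈ fockSubmodule := by
  rw [mem_fockSubmodule_iff hf]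
  -- The weight of `f` decays at rate `2 * b`; one `b` pays for the linear term through `2k‖z‖ ≤
  -- k²/b + b‖z‖²`, the other gives integrability.
  set b : ℝ := (1 - 2 * a) / 2 with hb
  have hb0 : 0 < b := by rw [hb]; linarith
  refine ((integrable_exp_neg_mul_sq hb0).const_mul (M ^ 2 * Real.exp (k ^ 2 / b))).mono'
    (continuous_wt hf.continuous).aestronglyMeasurable (ae_of_all _ fun z => ?_)
  rw [Real.norm_of_nonneg (wt_nonneg _ _), wt]
  calc ‖f z‖ ^ 2 * Real.exp (-‖z‖ ^ 2)
      ≤ (M * Real.exp (a * ‖z‖ ^ 2 + k * ‖z‖)) ^ 2 * Real.exp (-‖z‖ ^ 2) := by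
        gcongr; exact h z
    _ = M ^ 2 * Real.exp (2 * (a * ‖z‖ ^ 2 + k * ‖z‖) - ‖z‖ ^ 2) := by
        rw [mul_pow, ← Real.exp_nat_mul, mul_assoc, ← Real.exp_add]
        congr 2
    _ ≤ M ^ 2 * Real.exp (k ^ 2 / b + -b * ‖z‖ ^ 2) := by
        gcongr
        have h1 : 0 ≤ (k - b * ‖z‖) ^ 2 / b := by positivity
        have h2 : (k - b * ‖z‖) ^ 2 / b = k ^ 2 / b - 2 * k * ‖z‖ + b * ‖z‖ ^ 2 := by
          field_simp; ring
        have h3 : a = 1 / 2 - b := by rw [hb]; ring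
        rw [h3]
        linarith
    _ = _ := by rw [Real.exp_add, mul_assoc]

/-- A rotation followed by a translation preserves Lebesgue measure on `ℂ`. -/
theorem measurePreserving_mul_add {u : ℂ} (hu : ‖u‖ = 1) (v : ℂ) :
    MeasurePreserving (fun z : ℂ => u * z + v) := by
  have h := (rotation (⟨u, by simpa [Submonoid.unitSphere] using hu⟩ : Circle)).measurePreserving
  exact (measurePreserving_add_right volume v).comp h

theorem measurableEmbedding_mul_add {u : ℂ} (hu : u ≠ 0) (v : ℂ) :
    MeasurableEmbedding (fun z : ℂ => u * z + v) :=
  (((Homeomorph.mulLeft₀ u hu).trans (Homeomorph.addRight v))).measurableEmbedding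

theorem integral_gaussian_rotate {E : Type*} [NormedAddCommGroup E] [NormedSpace ℝ E] {u : ℂ}
    (hu : ‖u‖ = 1) (g : ℂ → E) : ∫ z, g (u * z) ∂gaussian = ∫ z, g z ∂gaussian := by
  have h := (measurePreserving_mul_add hu 0).integral_comp
      (measurableEmbedding_mul_add (norm_ne_zero_iff.1 (by simp [hu])) 0)
      (fun z => Real.exp (-‖z‖ ^ 2) • g z)
  rw [integral_gaussian, integral_gaussian, ← h]
  simp [hu]

theorem integrable_gaussian_rotate {u : ℂ} (hu : ‖u‖ = 1) {g : ℂ → ℂ} (hg : Integrable g gaussian) :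
    Integrable (fun z => g (u * z)) gaussian := by
  rw [integrable_gaussian_iff] at hg ⊢
  have := (measurePreserving_mul_add hu 0).integrable_comp_of_integrable hg
  simpa [Function.comp_def, hu] using this

/-- The mean value property for the Gaussian measure. -/
theorem integral_gaussian_eq {g : ℂ → ℂ} (hg : Differentiable ℂ g) (hi : Integrable g gaussian) :
    ∫ z, g z ∂gaussian = g 0 := by
  have hcont := hg.continuous
  have hexp : ∀ θ : ℝ, ‖Complex.exp (θ * Complex.I)‖ = 1 := Complex.norm_exp_ofReal_mul_I
  have havg : ∀ z : ℂ, ∫ θ in Set.Ioc 0 (2 * Real.pi), g (Complex.exp (θ * Complex.I) * z) =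
      (2 * Real.pi) * g 0 := by
    intro z
    have h1 : Differentiable ℂ fun ζ => g (ζ * z) := by fun_prop
    have h2 : Real.circleAverage (fun ζ => g (ζ * z)) 0 1 = g 0 := by
      simpa using (h1.diffContOnCl (s := Metric.ball 0 |1|)).circleAverage
    rw [Real.circleAverage_def, Complex.real_smul,
      intervalIntegral.integral_of_le (by positivity)] at h2
    simp only [circleMap_zero, Complex.ofReal_one, one_mul] at h2
    have : (Real.pi : ℂ) ≠ 0 := by exact_mod_cast Real.pi_ne_zero
    rw [← h2, ← mul_assoc, Complex.ofReal_inv, ← Complex.ofReal_ofNat, ← Complex.ofReal_mul,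
      mul_inv_cancel₀ (by simp [Real.pi_ne_zero]), one_mul]
  have hint : Integrable (Function.uncurry fun (θ : ℝ) (z : ℂ) =>
      g (Complex.exp (θ * Complex.I) * z))
      ((volume.restrict (Set.Ioc 0 (2 * Real.pi))).prod gaussian) := by
    rw [integrable_prod_iff]
    · refine ⟨ae_of_all _ fun θ => integrable_gaussian_rotate (hexp θ) hi, ?_⟩
      have : ∀ θ : ℝ, ∫ z, ‖g (Complex.exp (θ * Complex.I) * z)‖ ∂gaussian =
          ∫ z, ‖g z‖ ∂gaussian := fun θ => integral_gaussian_rotate (hexp θ) (fun z => ‖g z‖)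
      simp only [Function.uncurry_apply_pair, this]
      exact integrable_const _
    · have : Continuous (Function.uncurry fun (θ : ℝ) (z : ℂ) =>
        g (Complex.exp (θ * Complex.I) * z)) := by
        unfold Function.uncurry; fun_prop
      exact this.aestronglyMeasurable
  -- Fubini on rotations times the plane: one order uses rotation invariance of the measure, the
  -- other the mean value property on circles.
  have hswap := integral_integral_swap hint
  simp only [integral_gaussian_rotate (hexp _), havg] at hswap
  rw [integral_const, integral_const] at hswap
  simp only [probReal_univ, one_smul, measureReal_restrict_apply_univ, Real.volume_real_Ioc] at hswap
  rw [sub_zero, max_eq_left (by positivity), Complex.real_smul] at hswap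
  have : (2 * Real.pi : ℂ) ≠ 0 := by exact_mod_cast (by positivity : (2 * Real.pi) ≠ 0)
  push_cast at hswap
  exact mul_left_cancel₀ this hswap

/-! ### Reproducing kernels and weak convergence -/

/-- The reproducing kernel `K_w(z) = e^{w̄ z}` of the Fock space. -/
noncomputable def kernel (w : ℂ) : Fock :=
  Fock.mk (fun z => Complex.exp (conj w * z)) <|
    mem_fockSubmodule_of_growth (M := 1) (a := 0) (k := ‖w‖) (by fun_prop) (by norm_num) fun z => by
      rw [Complex.norm_exp, one_mul, zero_mul, zero_add]
      gcongr
      exact (Complex.re_le_norm _).trans (by simp)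

theorem kernel_apply (w z : ℂ) : kernel w z = Complex.exp (conj w * z) := rfl

/-- Translating by `w` turns the integrand into the entire function `exp (-(conj w * z)) * f (z +
w)` against the Gaussian, so the integral is its value at the origin. -/
theorem inner_kernel (w : ℂ) (f : Fock) : ⟪kernel w, f⟫_ℂ = f w := by
  have hi := Fock.integrable_mul (kernel w) f
  have hf := f.differentiable
  have hemb := measurableEmbedding_mul_add (one_ne_zero (α := ℂ)) w
  have hmp := measurePreserving_mul_add (norm_one (α := ℂ)) w
  have key : ∀ z : ℂ, Real.exp (-‖1 * z + w‖ ^ 2) •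
      (conj (kernel w (1 * z + w)) * f (1 * z + w)) =
      Real.exp (-‖z‖ ^ 2) • (Complex.exp (-(conj w * z)) * f (z + w)) := by
    intro z
    simp only [one_mul, kernel_apply, Complex.real_smul, ← mul_assoc, ← Complex.exp_conj,
      Complex.ofReal_exp, ← Complex.exp_add]
    congr 2
    push_cast
    rw [← Complex.mul_conj', ← Complex.mul_conj']
    simp only [map_mul, map_add, Complex.conj_conj]
    ring
  have hg : Integrable (fun z => Complex.exp (-(conj w * z)) * f (z + w)) gaussian := by
    rw [integrable_gaussian_iff] at hi ⊢
    refine (hmp.integrable_comp_of_integrable hi).congr (ae_of_all _ fun z => ?_)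
    exact key z
  rw [Fock.inner_def, integral_gaussian, ← hmp.integral_comp hemb]
  simp only [key]
  rw [← integral_gaussian, integral_gaussian_eq (by fun_prop) hg]
  simp

theorem norm_kernel_sq (w : ℂ) : ‖kernel w‖ ^ 2 = Real.exp (‖w‖ ^ 2) := by
  rw [@norm_sq_eq_re_inner ℂ, inner_kernel, kernel_apply, mul_comm, Complex.mul_conj']
  norm_cast

theorem norm_kernel (w : ℂ) : ‖kernel w‖ = Real.exp (‖w‖ ^ 2 / 2) := by
  rw [← sq_eq_sq₀ (norm_nonneg _) (Real.exp_pos _).le, norm_kernel_sq, ← Real.exp_nat_mul]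
  congr 1; push_cast; ring

theorem Fock.norm_apply_le_exp (f : Fock) (z : ℂ) : ‖f z‖ ≤ Real.exp (‖z‖ ^ 2 / 2) * ‖f‖ := by
  rw [← inner_kernel, ← norm_kernel]
  exact norm_inner_le_norm _ _

theorem dense_span_kernel : Dense (Submodule.span ℂ (Set.range kernel) : Set Fock) := by
  rw [Submodule.dense_iff_topologicalClosure_eq_top, Submodule.topologicalClosure_eq_top_iff,
    Submodule.eq_bot_iff]
  intro f hf
  ext w
  rw [← inner_kernel, Fock.zero_apply]
  exact hf _ (Submodule.subset_span ⟨w, rfl⟩)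

theorem Fock.tendsto_apply {ι : Type*} {l : Filter ι} {u : ι → Fock} {f : Fock}
    (h : Tendsto u l (𝓝 f)) (z : ℂ) : Tendsto (fun i => u i z) l (𝓝 (f z)) := by
  simp only [← inner_kernel]
  exact tendsto_const_nhds.inner h

/-- A bounded, pointwise convergent family converges weakly. -/
theorem Fock.tendsto_inner_of_bounded {ι : Type*} {l : Filter ι} {u : ι → Fock} {f : Fock} {M : ℝ}
    (hM : ∀ᶠ i in l, ‖u i‖ ≤ M) (h : ∀ z, Tendsto (fun i => u i z) l (𝓝 (f z))) (g : Fock) :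
    Tendsto (fun i => ⟪g, u i⟫_ℂ) l (𝓝 ⟪g, f⟫_ℂ) := by
  have hspan : ∀ k ∈ Submodule.span ℂ (Set.range kernel),
      Tendsto (fun i => ⟪k, u i⟫_ℂ) l (𝓝 ⟪k, f⟫_ℂ) := by
    intro k hk
    induction hk using Submodule.span_induction with
    | mem k hk =>
      obtain ⟨w, rfl⟩ := hk
      simpa only [inner_kernel] using h w
    | zero => simpa only [inner_zero_left] using tendsto_const_nhds
    | add a b _ _ ha hb => simpa only [inner_add_left] using ha.add hb
    | smul c a _ ha => simpa only [inner_smul_left] using ha.const_mul _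
  rw [Metric.tendsto_nhds]
  intro ε hε
  set K : ℝ := |M| + ‖f‖ + 1 with hK
  have hK0 : 0 < K := by positivity
  obtain ⟨k, hk, hgk⟩ := dense_span_kernel.exists_dist_lt g (show 0 < ε / (2 * K) by positivity)
  rw [dist_eq_norm] at hgk
  filter_upwards [hM, Metric.tendsto_nhds.1 (hspan k hk) (ε / 2) (by positivity)] with i h1 h2
  rw [dist_eq_norm] at h2 ⊢
  have h3 : ⟪g, u i⟫_ℂ - ⟪g, f⟫_ℂ = ⟪g - k, u i - f⟫_ℂ + (⟪k, u i⟫_ℂ - ⟪k, f⟫_ℂ) := by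
    simp only [inner_sub_left, inner_sub_right]; ring
  have h4 : ‖⟪g - k, u i - f⟫_ℂ‖ ≤ ε / (2 * K) * K := by
    refine (norm_inner_le_norm _ _).trans ?_
    gcongr
    refine (norm_sub_le _ _).trans ?_
    have := le_abs_self M
    linarith
  have h5 : ε / (2 * K) * K = ε / 2 := by field_simp
  rw [h3]
  refine (norm_add_le _ _).trans_lt ?_
  linarith

end FockWCO

/-! ### Closedness of the maximal operator and adjoints on kernels -/

namespace FockWCO

open scoped LinearPMap

section MaxOp

variable {ψ φ : ℂ → ℂ}

theorem maxOp_apply (f : (maxOp ψ φ).domain) (z : ℂ) :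
    maxOp ψ φ f z = ψ z * (f : Fock) (φ z) := rfl

theorem mem_maxOp_domain_of_eq {f g : Fock} (h : ∀ z, g z = ψ z * f (φ z)) :
    f ∈ (maxOp ψ φ).domain := by
  have : expr ψ φ f = g := funext fun z => (h z).symm
  show expr ψ φ f ∈ fockSubmodule
  rw [this]
  exact g.mem

theorem maxOp_eq {f g : Fock} (h : ∀ z, g z = ψ z * f (φ z)) :
    maxOp ψ φ ⟨f, mem_maxOp_domain_of_eq h⟩ = g :=
  Fock.ext fun z => (h z).symm

theorem mem_maxOp_graph_iff {p : Fock × Fock} :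
    p ∈ (maxOp ψ φ).graph ↔ ∀ z, p.2 z = ψ z * p.1 (φ z) := by
  rw [LinearPMap.mem_graph_iff]
  constructor
  · rintro ⟨f, hf, hp⟩ z
    rw [← hp, maxOp_apply, hf]
  · intro h
    exact ⟨⟨p.1, mem_maxOp_domain_of_eq h⟩, rfl, maxOp_eq h⟩

/-- The graph is cut out by pointwise equations, and point evaluations are continuous. -/
theorem maxOp_isClosed (ψ φ : ℂ → ℂ) : (maxOp ψ φ).IsClosed := by
  refine IsSeqClosed.isClosed fun u p hu hp => ?_
  rw [SetLike.mem_coe, mem_maxOp_graph_iff]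
  intro z
  have h1 := Fock.tendsto_apply ((continuous_snd.tendsto p).comp hp) z
  have h2 := (Fock.tendsto_apply ((continuous_fst.tendsto p).comp hp) (φ z)).const_mul (ψ z)
  refine tendsto_nhds_unique h1 (h2.congr fun n => ?_)
  exact (mem_maxOp_graph_iff.1 (hu n) z).symm

theorem IsWeightedComp.apply {W : Fock →ₗ.[ℂ] Fock} (hW : IsWeightedComp ψ φ W) (f : W.domain)
    (z : ℂ) : W f z = ψ z * (f : Fock) (φ z) := by
  rw [hW.2 (x := f) (y := ⟨f, hW.1 f.2⟩) rfl, maxOp_apply]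

theorem IsWeightedComp.inner_smul_kernel {W : Fock →ₗ.[ℂ] Fock} (hW : IsWeightedComp ψ φ W)
    (w : ℂ) (f : W.domain) :
    ⟪conj (ψ w) • kernel (φ w), (f : Fock)⟫_ℂ = ⟪kernel w, W f⟫_ℂ := by
  rw [inner_smul_left, inner_kernel, inner_kernel, hW.apply, Complex.conj_conj]

theorem IsWeightedComp.kernel_mem_adjoint_domain {W : Fock →ₗ.[ℂ] Fock}
    (hW : IsWeightedComp ψ φ W) (w : ℂ) : kernel w ∈ W†.domain :=
  LinearPMap.mem_adjoint_domain_of_exists _ ⟨_, hW.inner_smul_kernel w⟩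

theorem IsWeightedComp.adjoint_kernel {W : Fock →ₗ.[ℂ] Fock} (hW : IsWeightedComp ψ φ W)
    (hd : Dense (W.domain : Set Fock)) (w : ℂ) :
    W† ⟨kernel w, hW.kernel_mem_adjoint_domain w⟩ = conj (ψ w) • kernel (φ w) :=
  LinearPMap.adjoint_apply_eq hd _ (hW.inner_smul_kernel w)

end MaxOp

/-! ### Exponential symbols: adjoint symbols and the comparison by rigid motions -/

/-- The maximal weighted composition operator with symbols `ψ(z) = C e^{Dz}`, `φ(z) = Az + B`. -/
noncomputable def expOp (A B C D : ℂ) : Fock →ₗ.[ℂ] Fock :=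
  maxOp (fun z => C * Complex.exp (D * z)) (fun z => A * z + B)

variable {A B C D : ℂ}

theorem expOp_apply (f : (expOp A B C D).domain) (z : ℂ) :
    expOp A B C D f z = C * Complex.exp (D * z) * (f : Fock) (A * z + B) := rfl

theorem differentiable_expr_exp (f : Fock) : Differentiable ℂ
    (expr (fun z => C * Complex.exp (D * z)) (fun z => A * z + B) f) := by
  have := f.differentiable
  unfold expr
  fun_prop

theorem kernel_expOp (w z : ℂ) :
    ((C * Complex.exp (conj w * B)) • kernel (conj A * w + conj D) : Fock) z =
      C * Complex.exp (D * z) * kernel w (A * z + B) := by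
  rw [Fock.smul_apply, kernel_apply, kernel_apply, mul_assoc, mul_assoc, ← Complex.exp_add,
    ← Complex.exp_add]
  simp only [map_add, map_mul, Complex.conj_conj]
  ring_nf

theorem kernel_mem_expOp_domain (w : ℂ) : kernel w ∈ (expOp A B C D).domain :=
  mem_maxOp_domain_of_eq (kernel_expOp w)

theorem expOp_kernel (w : ℂ) : expOp A B C D ⟨kernel w, kernel_mem_expOp_domain w⟩ =
    (C * Complex.exp (conj w * B)) • kernel (conj A * w + conj D) :=
  maxOp_eq (kernel_expOp w)

theorem dense_expOp_domain : Dense ((expOp A B C D).domain : Set Fock) := by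
  refine dense_span_kernel.mono ?_
  rw [SetLike.coe_subset_coe, Submodule.span_le]
  rintro _ ⟨w, rfl⟩
  exact kernel_mem_expOp_domain w

/-- The adjoint of `expOp A B C D` is a restriction of the maximal operator of the same kind with
the adjoint symbols. -/
theorem adjoint_expOp_le :
    (expOp A B C D)† ≤ expOp (conj A) (conj D) (conj C) (conj B) := by
  have h : ∀ (f : (expOp A B C D)†.domain) z, (expOp A B C D)† f z =
      conj C * Complex.exp (conj B * z) * (f : Fock) (conj A * z + conj D) := by
    intro f z
    have := LinearPMap.adjoint_isFormalAdjoint (dense_expOp_domain (A := A) (B := B) (C := C)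
      (D := D)) f ⟨kernel z, kernel_mem_expOp_domain z⟩
    rw [expOp_kernel, ← inner_conj_symm, inner_kernel, inner_smul_right, ← inner_conj_symm,
      inner_kernel] at this
    have h2 := congrArg conj this
    simp only [Complex.conj_conj, map_mul, ← Complex.exp_conj] at h2
    rw [h2, mul_comm z]
  exact ⟨fun f hf => mem_maxOp_domain_of_eq (h ⟨f, hf⟩),
    fun f g hfg => Fock.ext fun z => by rw [h, expOp_apply, hfg]⟩

theorem wt_exp (f : ℂ → ℂ) (z : ℂ) :
    wt (expr (fun z => C * Complex.exp (D * z)) (fun z => A * z + B) f) z =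
      ‖C‖ ^ 2 * ‖f (A * z + B)‖ ^ 2 * Real.exp (2 * (D * z).re - ‖z‖ ^ 2) := by
  rw [wt, expr, norm_mul, norm_mul, Complex.norm_exp, mul_pow, mul_pow, ← Real.exp_nat_mul,
    sub_eq_add_neg, Real.exp_add]
  push_cast
  ring

theorem exponent_eq (D z : ℂ) : ((2 * (D * z).re - ‖z‖ ^ 2 : ℝ) : ℂ) =
    D * z + conj D * conj z - z * conj z := by
  rw [← map_mul, Complex.add_conj, Complex.mul_conj']
  push_cast
  ring

section Comparison

variable {A' B' C' D' u v : ℂ} {c : ℝ}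

/-- The motion `w ↦ u * w + v` makes both operators evaluate `f` at the same point, by `hφ`, and
shifts the exponent of the weight by a constant, by `hc`. The exponents are kept as complex
polynomials in `w` and `conj w` so that `hc` can be checked by ring arithmetic. -/
theorem wt_expr_comp (hC : ‖C'‖ = ‖C‖) (hφ : ∀ w, A * (u * w + v) + B = A' * w + B')
    (hc : ∀ w, D * (u * w + v) + conj D * conj (u * w + v) - (u * w + v) * conj (u * w + v) =
      D' * w + conj D' * conj w - w * conj w + c) (f : ℂ → ℂ) (w : ℂ) :
    wt (expr (fun z => C * Complex.exp (D * z)) (fun z => A * z + B) f) (u * w + v) =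
      Real.exp c *
        wt (expr (fun z => C' * Complex.exp (D' * z)) (fun z => A' * z + B') f) w := by
  have h : 2 * (D * (u * w + v)).re - ‖u * w + v‖ ^ 2 = 2 * (D' * w).re - ‖w‖ ^ 2 + c := by
    have := hc w
    rw [← exponent_eq, ← exponent_eq] at this
    exact_mod_cast this
  rw [wt_exp, wt_exp, h, hφ, hC, Real.exp_add]
  ring

theorem mem_expOp_domain_of_comp (hu : ‖u‖ = 1) (hC : ‖C'‖ = ‖C‖)
    (hφ : ∀ w, A * (u * w + v) + B = A' * w + B')
    (hc : ∀ w, D * (u * w + v) + conj D * conj (u * w + v) - (u * w + v) * conj (u * w + v) =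
      D' * w + conj D' * conj w - w * conj w + c) {f : Fock} :
    f ∈ (expOp A B C D).domain ↔ f ∈ (expOp A' B' C' D').domain := by
  have hmp := measurePreserving_mul_add hu v
  have hemb := measurableEmbedding_mul_add (norm_ne_zero_iff.1 (hu ▸ one_ne_zero)) v
  change expr _ _ f ∈ fockSubmodule ↔ expr _ _ f ∈ fockSubmodule
  rw [mem_fockSubmodule_iff (differentiable_expr_exp f),
    mem_fockSubmodule_iff (differentiable_expr_exp f), ← hmp.integrable_comp_emb hemb]
  simp only [Function.comp_def, wt_expr_comp hC hφ hc]
  exact integrable_const_mul_iff (Real.exp_pos c).ne'.isUnit _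

theorem norm_expOp_comp (hu : ‖u‖ = 1) (hC : ‖C'‖ = ‖C‖)
    (hφ : ∀ w, A * (u * w + v) + B = A' * w + B')
    (hc : ∀ w, D * (u * w + v) + conj D * conj (u * w + v) - (u * w + v) * conj (u * w + v) =
      D' * w + conj D' * conj w - w * conj w + c) (f : (expOp A B C D).domain)
    (g : (expOp A' B' C' D').domain) (hfg : (f : Fock) = g) :
    ‖expOp A B C D f‖ ^ 2 = Real.exp c * ‖expOp A' B' C' D' g‖ ^ 2 := by
  have hmp := measurePreserving_mul_add hu v
  have hemb := measurableEmbedding_mul_add (norm_ne_zero_iff.1 (hu ▸ one_ne_zero)) v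
  rw [Fock.norm_sq_eq_integral_wt, Fock.norm_sq_eq_integral_wt]
  change _ * ∫ z, wt (expr _ _ (f : Fock)) z = _ * (_ * ∫ z, wt (expr _ _ (g : Fock)) z)
  rw [← hmp.integral_comp hemb]
  simp only [wt_expr_comp hC hφ hc, hfg]
  rw [integral_const_mul]
  ring

end Comparison

theorem exists_unit_mul_eq_conj (A : ℂ) : ∃ u : ℂ, ‖u‖ = 1 ∧ A * u = conj A := by
  rcases eq_or_ne A 0 with rfl | hA
  · exact ⟨1, by simp, by simp⟩
  · exact ⟨conj A / A, by simp [hA], by field_simp⟩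

/-- If `A ≠ 1`, the maximal operator and the operator with the adjoint symbols differ by
an isometric change of variables. -/
theorem exists_comparison_of_ne_one (hA : A ≠ 1) (hD : D = conj B * (1 - A) * (1 - conj A)⁻¹) :
    ∃ u v : ℂ, ‖u‖ = 1 ∧ (∀ w, A * (u * w + v) + B = conj A * w + conj D) ∧
      ∀ w, D * (u * w + v) + conj D * conj (u * w + v) - (u * w + v) * conj (u * w + v) =
        conj B * w + conj (conj B) * conj w - w * conj w + (0 : ℝ) := by
  obtain ⟨u, hu, hAu⟩ := exists_unit_mul_eq_conj A
  have h1 : 1 - A ≠ 0 := sub_ne_zero.2 hA.symm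
  have h2 : 1 - conj A ≠ 0 := by
    intro h
    apply h1
    have := congrArg conj h
    simpa using this
  -- The fixed point of `z ↦ A * z + B`; in terms of it the condition on `D` reads `D = conj p * (1
  -- - A)`.
  obtain ⟨p, hp⟩ : ∃ p, p = B / (1 - A) := ⟨_, rfl⟩
  have hB : B = p * (1 - A) := by rw [hp]; field_simp
  have hD' : D = conj p * (1 - A) := by
    rw [hD, hB]; simp only [map_mul, map_sub, map_one]; field_simp
  have huu : u * conj u = 1 := by rw [Complex.mul_conj', hu]; simp
  have hAu' : conj A * conj u = A := by rw [← map_mul, hAu, Complex.conj_conj]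
  -- The motion is the rotation by `u` about the fixed point `p`.
  refine ⟨u, p - u * p, hu, fun w => ?_, fun w => ?_⟩
  · rw [hD', hB]
    simp only [map_mul, map_sub, map_one, Complex.conj_conj]
    linear_combination (w - p) * hAu
  · rw [hD', hB]
    simp only [map_mul, map_sub, map_one, Complex.conj_conj, map_add, Complex.ofReal_zero]
    linear_combination (-conj p * (w - p)) * hAu - (p * (conj w - conj p)) * hAu' -
      ((w - p) * (conj w - conj p)) * huu

/-- For `A = 1` the motion is the translation taking `w + conj D` to the role of `z + B`; the
constant it produces is what forces the comparison of `‖D‖` with `‖B‖`. -/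
theorem comparison_translation (w : ℂ) :
    D * (1 * w + (conj D - B)) + conj D * conj (1 * w + (conj D - B)) -
        (1 * w + (conj D - B)) * conj (1 * w + (conj D - B)) =
      conj B * w + conj (conj B) * conj w - w * conj w + ((‖D‖ ^ 2 - ‖B‖ ^ 2 : ℝ) : ℂ) := by
  push_cast
  rw [← Complex.mul_conj', ← Complex.mul_conj']
  simp only [map_mul, map_sub, map_one, Complex.conj_conj, map_add]
  ring

/-- The conditions on the symbols in the characterization of cohyponormality. -/
def Admissible (A B D : ℂ) : Prop :=
  (A ≠ 1 ∧ D = conj B * (1 - A) * (1 - conj A)⁻¹) ∨ (A = 1 ∧ ‖D‖ ≤ ‖B‖)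

theorem Admissible.exists_comparison (h : Admissible A B D) :
    ∃ (u v : ℂ) (c : ℝ), ‖u‖ = 1 ∧ c ≤ 0 ∧ (∀ w, A * (u * w + v) + B = conj A * w + conj D) ∧
      ∀ w, D * (u * w + v) + conj D * conj (u * w + v) - (u * w + v) * conj (u * w + v) =
        conj B * w + conj (conj B) * conj w - w * conj w + c := by
  rcases h with ⟨hA, hD⟩ | ⟨rfl, hD⟩
  · obtain ⟨u, v, hu, h1, h2⟩ := exists_comparison_of_ne_one hA hD
    exact ⟨u, v, 0, hu, le_rfl, h1, h2⟩
  · refine ⟨1, conj D - B, ‖D‖ ^ 2 - ‖B‖ ^ 2, norm_one, ?_, fun w => ?_, comparison_translation⟩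
    · have := pow_le_pow_left₀ (norm_nonneg D) hD 2
      linarith
    · simp; ring

theorem Admissible.mem_domain_iff (h : Admissible A B D) {f : Fock} :
    f ∈ (expOp A B C D).domain ↔ f ∈ (expOp (conj A) (conj D) (conj C) (conj B)).domain := by
  obtain ⟨u, v, c, hu, -, h1, h2⟩ := h.exists_comparison
  exact mem_expOp_domain_of_comp hu (by simp) h1 h2

theorem Admissible.isCohyponormal (h : Admissible A B D) : IsCohyponormal (expOp A B C D) where
  dense := dense_expOp_domain
  closed := maxOp_isClosed _ _
  domain_le := fun _ hf => h.mem_domain_iff.2 (adjoint_expOp_le.1 hf)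
  norm_le := fun f => by
    obtain ⟨u, v, c, hu, hc, h1, h2⟩ := h.exists_comparison
    have h3 := norm_expOp_comp hu (by simp) h1 h2
      ⟨f, h.mem_domain_iff.2 (adjoint_expOp_le.1 f.2)⟩
      (⟨f, adjoint_expOp_le.1 f.2⟩ : (expOp (conj A) (conj D) (conj C) (conj B)).domain) rfl
    rw [adjoint_expOp_le.2 (x := f)
      (y := (⟨f, adjoint_expOp_le.1 f.2⟩ : (expOp (conj A) (conj D) (conj C) (conj B)).domain)) rfl,
      ← sq_le_sq₀ (norm_nonneg _) (norm_nonneg _), h3]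
    exact mul_le_of_le_one_left (sq_nonneg _) (Real.exp_le_one_iff.2 hc)

end FockWCO

/-! ### Formal adjointness with the adjoint symbols, and maximality -/

namespace FockWCO

variable {A B C D : ℂ}

/-- `expOp A B C D` and the operator with the adjoint symbols are formally adjoint. -/
def IsAdjointPair (A B C D : ℂ) : Prop :=
  (expOp A B C D).IsFormalAdjoint (expOp (conj A) (conj D) (conj C) (conj B))

/-- An everywhere defined operator of this kind is bounded by the closed graph theorem, so the
adjoint identity only has to be checked on kernels. -/
theorem isAdjointPair_of_domain_eq_top (h : ∀ f, f ∈ (expOp A B C D).domain) :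
    IsAdjointPair A B C D := by
  intro f g
  let L : Fock →ₗ[ℂ] Fock := (expOp A B C D).toFun.comp (LinearMap.id.codRestrict _ h)
  have hL : ∀ (k : Fock) z, L k z = C * Complex.exp (D * z) * k (A * z + B) := fun _ _ => rfl
  have hc : Continuous L := by
    refine L.continuous_of_seq_closed_graph fun u x y hu hy => Fock.ext fun z => ?_
    have h1 := Fock.tendsto_apply hy z
    have h2 := (Fock.tendsto_apply hu (A * z + B)).const_mul (C * Complex.exp (D * z))
    exact tendsto_nhds_unique h1 h2
  have key : ∀ k : Fock, ⟪(g : Fock), L k⟫_ℂ =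
      ⟪expOp (conj A) (conj D) (conj C) (conj B) g, k⟫_ℂ := by
    have hspan : Set.EqOn (fun k : Fock => ⟪(g : Fock), L k⟫_ℂ)
        (fun k => ⟪expOp (conj A) (conj D) (conj C) (conj B) g, k⟫_ℂ)
        (Submodule.span ℂ (Set.range kernel) : Set Fock) := by
      intro k hk
      simp only
      induction hk using Submodule.span_induction with
      | mem k hk =>
        obtain ⟨w, rfl⟩ := hk
        have : L (kernel w) = (C * Complex.exp (conj w * B)) • kernel (conj A * w + conj D) :=
          Fock.ext fun z => by rw [hL, kernel_expOp]
        rw [this, inner_smul_right, ← inner_conj_symm, inner_kernel, ← inner_conj_symm,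
          inner_kernel, expOp_apply]
        simp only [map_mul, ← Complex.exp_conj, Complex.conj_conj, mul_comm B]
      | zero => rw [map_zero, inner_zero_right, inner_zero_right]
      | add a b _ _ ha hb => rw [map_add, inner_add_right, inner_add_right, ha, hb]
      | smul c a _ ha => rw [map_smul, inner_smul_right, inner_smul_right, ha]
    exact congrFun (Continuous.ext_on dense_span_kernel (continuous_const.inner hc)
      (continuous_const.inner continuous_id) hspan)
  have h2 : expOp A B C D f = L f := rfl
  rw [h2, ← inner_conj_symm, key, inner_conj_symm]

theorem mem_expOp_domain_of_norm_lt_one (hA : ‖A‖ < 1) (f : Fock) :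
    f ∈ (expOp A B C D).domain := by
  refine mem_fockSubmodule_of_growth (M := ‖C‖ * Real.exp (‖B‖ ^ 2 / 2) * ‖f‖)
    (a := ‖A‖ ^ 2 / 2) (k := ‖D‖ + ‖A‖ * ‖B‖) (differentiable_expr_exp f) ?_ fun z => ?_
  · have := pow_lt_one₀ (norm_nonneg A) hA two_ne_zero
    linarith
  · have h1 : ‖A * z + B‖ ≤ ‖A‖ * ‖z‖ + ‖B‖ := (norm_add_le _ _).trans (by rw [norm_mul])
    have h2 : (D * z).re ≤ ‖D‖ * ‖z‖ := (Complex.re_le_norm _).trans (by rw [norm_mul])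
    calc ‖C * Complex.exp (D * z) * f (A * z + B)‖
        ≤ ‖C‖ * Real.exp (‖D‖ * ‖z‖) * (Real.exp ((‖A‖ * ‖z‖ + ‖B‖) ^ 2 / 2) * ‖f‖) := by
          rw [norm_mul, norm_mul, Complex.norm_exp]
          gcongr
          refine (f.norm_apply_le_exp _).trans ?_
          gcongr
      _ = ‖C‖ * ‖f‖ * Real.exp (‖D‖ * ‖z‖ + (‖A‖ * ‖z‖ + ‖B‖) ^ 2 / 2) := by
          rw [Real.exp_add]; ring
      _ = ‖C‖ * ‖f‖ * Real.exp (‖B‖ ^ 2 / 2 +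
            (‖A‖ ^ 2 / 2 * ‖z‖ ^ 2 + (‖D‖ + ‖A‖ * ‖B‖) * ‖z‖)) := by
          congr 2; ring
      _ = _ := by rw [Real.exp_add]; ring

/-- This `D` makes the exponent equal to `‖B‖² - ‖A * z + B‖²`, so the weight of the image is a
constant times the weight of `f` moved by an isometry. -/
theorem mem_expOp_domain_of_norm_eq_one (hA : ‖A‖ = 1) (hD : D = -conj B * A) (f : Fock) :
    f ∈ (expOp A B C D).domain := by
  have hAA : A * conj A = 1 := by rw [Complex.mul_conj', hA]; simp
  change expr _ _ f ∈ fockSubmodule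
  rw [mem_fockSubmodule_iff (differentiable_expr_exp f)]
  have hi := (measurePreserving_mul_add hA B).integrable_comp_of_integrable f.integrable_wt
  refine (hi.const_mul (‖C‖ ^ 2 * Real.exp (‖B‖ ^ 2))).congr (ae_of_all _ fun z => ?_)
  have h : 2 * (D * z).re - ‖z‖ ^ 2 = ‖B‖ ^ 2 + -‖A * z + B‖ ^ 2 := by
    have h1 : ((2 * (D * z).re - ‖z‖ ^ 2 : ℝ) : ℂ) = ((‖B‖ ^ 2 + -‖A * z + B‖ ^ 2 : ℝ) : ℂ) := by
      rw [exponent_eq]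
      push_cast
      rw [← Complex.mul_conj', ← Complex.mul_conj', hD]
      simp only [map_mul, map_neg, map_add, Complex.conj_conj]
      linear_combination (z * conj z) * hAA
    exact_mod_cast h1
  rw [wt_exp, h, Real.exp_add]
  simp only [Function.comp_apply, wt]
  ring

theorem mul_exp_mul_exp {C C' a b : ℂ} (hC : C * C' = Complex.exp (-(a + b))) :
    C * Complex.exp a * (C' * Complex.exp b) = 1 := by
  calc _ = C * C' * Complex.exp (a + b) := by rw [Complex.exp_add]; ring
    _ = 1 := by rw [hC, ← Complex.exp_add, neg_add_cancel, Complex.exp_zero]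

/-- The inverse has the same form with multiplier `A⁻¹` inside the unit disc, hence is everywhere
defined, and its adjoint symbols invert the adjoint symbols of the original. Its adjoint identity,
applied to the images `u` and `v`, is the one wanted. -/
theorem isAdjointPair_of_one_lt_norm (hA : 1 < ‖A‖) (hC : C ≠ 0) : IsAdjointPair A B C D := by
  intro f g
  have hA0 : A ≠ 0 := norm_pos_iff.1 (one_pos.trans hA)
  have hA0' : conj A ≠ 0 := (map_ne_zero _).2 hA0
  -- Normalised so that the two exponential weights multiply to `1` after composition.
  set C' : ℂ := C⁻¹ * Complex.exp (D * B / A) with hC'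
  have hlt : ‖A⁻¹‖ < 1 := by rw [norm_inv]; exact inv_lt_one_of_one_lt₀ hA
  have hS : IsAdjointPair A⁻¹ (-B / A) C' (-D / A) :=
    isAdjointPair_of_domain_eq_top (mem_expOp_domain_of_norm_lt_one hlt)
  set u := expOp A B C D f with hu
  set v := expOp (conj A) (conj D) (conj C) (conj B) g with hv
  have hCC : C * C' = Complex.exp (D * B / A) := by rw [hC', ← mul_assoc, mul_inv_cancel₀ hC, one_mul]
  have h1 : ∀ z, (f : Fock) z =
      C' * Complex.exp (-D / A * z) * u (A⁻¹ * z + -B / A) := by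
    intro z
    rw [hu, expOp_apply, show A * (A⁻¹ * z + -B / A) + B = z by field_simp; ring, ← mul_assoc,
      mul_exp_mul_exp, one_mul]
    rw [mul_comm, hCC]
    congr 1; field_simp; ring
  have h2 : ∀ z, (g : Fock) z = conj C' * Complex.exp (conj (-B / A) * z) *
      v (conj A⁻¹ * z + conj (-D / A)) := by
    intro z
    simp only [map_inv₀, map_div₀, map_neg]
    rw [hv, expOp_apply, show conj A * ((conj A)⁻¹ * z + -conj D / conj A) + conj D = z by
      field_simp; ring, ← mul_assoc, mul_exp_mul_exp, one_mul]
    rw [mul_comm, ← map_mul, hCC, ← Complex.exp_conj, map_div₀, map_mul]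
    congr 1; field_simp; ring
  have h3 := hS ⟨u, mem_maxOp_domain_of_eq h1⟩ ⟨v, mem_maxOp_domain_of_eq h2⟩
  have h4 : expOp A⁻¹ (-B / A) C' (-D / A) ⟨u, mem_maxOp_domain_of_eq h1⟩ = f := maxOp_eq h1
  have h5 : expOp (conj A⁻¹) (conj (-D / A)) (conj C') (conj (-B / A))
    ⟨v, mem_maxOp_domain_of_eq h2⟩ = g := maxOp_eq h2
  rw [h4, h5] at h3
  exact h3.symm

/-- With `s = z + B`, both sides evaluate `f` at `r * s`. Only the exponents differ, and the gain
`-(1 - r²)‖s‖²` absorbs the linear term uniformly in `r`. -/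
theorem wt_dilate_le (f : ℂ → ℂ) {r : ℝ} (hr : 1 / 2 ≤ r) (hr1 : r < 1) (z : ℂ) :
    wt (expr (fun z => C * Complex.exp (D * z)) (fun z => r * z + r * B) f) z ≤
      Real.exp (‖D + conj B‖ ^ 2 / 2) *
        wt (expr (fun z => C * Complex.exp (D * z)) (fun z => 1 * z + B) f)
          (r • z + (r * B - B)) := by
  have hr0 : 0 < r := by linarith
  rw [wt_exp, wt_exp, show 1 * (r • z + (r * B - B)) + B = r * z + r * B by
    rw [Complex.real_smul]; ring]
  have hmain : 2 * (D * z).re - ‖z‖ ^ 2 ≤ ‖D + conj B‖ ^ 2 / 2 +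
      (2 * (D * (r • z + (r * B - B))).re - ‖r • z + (r * B - B)‖ ^ 2) := by
    obtain ⟨s, hs⟩ : ∃ s, s = z + B := ⟨_, rfl⟩
    have hz : z = s - B := by rw [hs]; ring
    have hz' : r • z + (r * B - B) = r * s - B := by rw [Complex.real_smul, hs]; ring
    rw [hz', hz]
    have e1 : ∀ t : ℝ, 2 * (D * (t * s - B)).re - ‖t * s - B‖ ^ 2 =
        2 * t * ((D + conj B) * s).re - t ^ 2 * ‖s‖ ^ 2 - 2 * (D * B).re - ‖B‖ ^ 2 := by
      intro t
      simp only [Complex.sq_norm, Complex.normSq_apply, Complex.sub_re, Complex.sub_im,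
        Complex.mul_re, Complex.mul_im, Complex.ofReal_re, Complex.ofReal_im, Complex.add_re,
        Complex.add_im, Complex.conj_re, Complex.conj_im]
      ring
    have e2 := e1 1
    simp only [Complex.ofReal_one, one_mul, one_pow] at e2
    rw [e1 r, e2]
    have h1 : ((D + conj B) * s).re ≤ ‖D + conj B‖ * ‖s‖ :=
      (Complex.re_le_norm _).trans (norm_mul_le _ _)
    have h2 : (1 - r) * ((D + conj B) * s).re ≤ (1 - r) * (‖D + conj B‖ * ‖s‖) := by
      gcongr
    have h3 : (1 - r) * (2 * (‖D + conj B‖ * ‖s‖) - (1 + r) * ‖s‖ ^ 2) ≤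
        (1 - r) * ‖D + conj B‖ ^ 2 := by
      refine mul_le_mul_of_nonneg_left ?_ (by linarith)
      nlinarith [sq_nonneg (‖D + conj B‖ - ‖s‖), mul_nonneg hr0.le (sq_nonneg ‖s‖)]
    have h4 : (1 - r) * ‖D + conj B‖ ^ 2 ≤ 1 / 2 * ‖D + conj B‖ ^ 2 := by
      gcongr; linarith
    nlinarith
  rw [mul_left_comm, ← Real.exp_add]
  gcongr

theorem norm_dilate_le (f : (expOp 1 B C D).domain) {r : ℝ} (hr : 1 / 2 ≤ r) (hr1 : r < 1)
    (g : (expOp r (r * B) C D).domain) (hfg : (f : Fock) = g) :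
    ‖expOp r (r * B) C D g‖ ^ 2 ≤
      4 * Real.exp (‖D + conj B‖ ^ 2 / 2) * ‖expOp 1 B C D f‖ ^ 2 := by
  have hr0 : 0 < r := by linarith
  rw [Fock.norm_sq_eq_integral_wt, Fock.norm_sq_eq_integral_wt]
  have hi := (expOp 1 B C D f).integrable_wt
  set w := wt (expOp 1 B C D f : Fock) with hw
  have hi' : Integrable fun z : ℂ => w (r • z + (r * B - B)) :=
    (integrable_comp_smul_iff volume (fun z => w (z + (r * B - B))) hr0.ne').2
      (hi.comp_add_right _)
  have hcomp : ∫ z : ℂ, w (r • z + (r * B - B)) = (r ^ 2)⁻¹ * ∫ z, w z := by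
    rw [Measure.integral_comp_smul_of_nonneg volume (fun z => w (z + (r * B - B))) r (hR := hr0.le),
      integral_add_right_eq_self, Complex.finrank_real_complex, smul_eq_mul]
  have hle : ∫ z, wt (expOp r (r * B) C D g : Fock) z ≤
      ∫ z, Real.exp (‖D + conj B‖ ^ 2 / 2) * w (r • z + (r * B - B)) := by
    refine integral_mono (Fock.integrable_wt _) (hi'.const_mul _) fun z => ?_
    change wt (expr _ _ (g : Fock)) z ≤ _ * wt (expr _ _ (f : Fock)) _
    rw [← hfg]
    exact wt_dilate_le _ hr hr1 z
  rw [integral_const_mul, hcomp] at hle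
  -- The Jacobian of the planar dilation; `1 / 2 ≤ r` is what bounds it.
  have hr4 : (r ^ 2)⁻¹ ≤ 4 := by
    rw [inv_le_comm₀ (by positivity) (by norm_num)]
    nlinarith
  have hw0 : 0 ≤ ∫ z, w z := integral_nonneg fun z => wt_nonneg _ z
  calc _ ≤ 1 / Real.pi * (Real.exp (‖D + conj B‖ ^ 2 / 2) * ((r ^ 2)⁻¹ * ∫ z, w z)) := by gcongr
    _ ≤ 1 / Real.pi * (Real.exp (‖D + conj B‖ ^ 2 / 2) * (4 * ∫ z, w z)) := by gcongr
    _ = _ := by ring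

theorem expOp_one_zero_one_zero (h : Fock) (z : ℂ) :
    h z = 1 * Complex.exp (0 * z) * h (1 * z + 0) := by simp

/-- Dilations approximate `expOp 1 B C D` weakly. -/
theorem tendsto_inner_dilate (f : (expOp 1 B C D).domain) (u : ℝ → Fock)
    (hu : ∀ᶠ r : ℝ in 𝓝[<] 1, ∀ z, u r z = C * Complex.exp (D * z) * (f : Fock) (r * z + r * B))
    (g : Fock) :
    Tendsto (fun r => ⟪g, u r⟫_ℂ) (𝓝[<] 1) (𝓝 ⟪g, expOp 1 B C D f⟫_ℂ) := by
  have hev : ∀ᶠ r : ℝ in 𝓝[<] 1, 1 / 2 ≤ r ∧ r < 1 := by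
    filter_upwards [Ioo_mem_nhdsLT (show (1 / 2 : ℝ) < 1 by norm_num)] with r hr
    exact ⟨hr.1.le, hr.2⟩
  refine Fock.tendsto_inner_of_bounded
    (M := √(4 * Real.exp (‖D + conj B‖ ^ 2 / 2) * ‖expOp 1 B C D f‖ ^ 2)) ?_ (fun z => ?_) g
  · filter_upwards [hu, hev] with r h1 h2
    refine Real.le_sqrt_of_sq_le ?_
    have h3 := norm_dilate_le f h2.1 h2.2 ⟨f, mem_maxOp_domain_of_eq h1⟩ rfl
    have h4 : expOp r (r * B) C D ⟨f, mem_maxOp_domain_of_eq h1⟩ = u r := maxOp_eq h1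
    rwa [h4] at h3
  · rw [expOp_apply, one_mul]
    have hc := (f : Fock).differentiable.continuous
    have h1 : Continuous fun r : ℝ => C * Complex.exp (D * z) * (f : Fock) (r * z + r * B) := by
      fun_prop
    have h2 := (h1.tendsto 1).mono_left (nhdsWithin_le_nhds (s := Set.Iio (1 : ℝ)))
    simp only [Complex.ofReal_one, one_mul] at h2
    refine h2.congr' ?_
    filter_upwards [hu] with r hr
    exact (hr z).symm

/-- For `A = 1` neither operator need be everywhere defined. Replacing `z + B` by `r * (z + B)` with
`r < 1` gives an everywhere defined operator, whose adjoint symbols applied to `g` give exactly the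
dilate `z ↦ v (r * z)`. Both sides of its adjoint identity converge weakly as `r → 1`. -/
theorem isAdjointPair_one : IsAdjointPair 1 B C D := by
  unfold IsAdjointPair
  rw [map_one]
  intro f g
  set v := expOp 1 (conj D) (conj C) (conj B) g with hv
  have hdom : ∀ {r : ℝ}, r ∈ Set.Ioo (0 : ℝ) 1 → ‖(r : ℂ)‖ < 1 := fun {r} hr => by
    rw [Complex.norm_real, Real.norm_of_nonneg hr.1.le]; exact hr.2
  have hIoo : Set.Ioo (0 : ℝ) 1 ∈ 𝓝[<] (1 : ℝ) := Ioo_mem_nhdsLT one_pos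
  choose! S hS using fun (r : ℝ) (hr : r ∈ Set.Ioo (0 : ℝ) 1) =>
    (⟨expOp r (r * B) C D ⟨f, mem_expOp_domain_of_norm_lt_one (hdom hr) _⟩, fun z => rfl⟩ :
      ∃ S : Fock, ∀ z, S z = C * Complex.exp (D * z) * (f : Fock) (r * z + r * B))
  choose! R hR using fun (r : ℝ) (hr : r ∈ Set.Ioo (0 : ℝ) 1) =>
    (⟨expOp r (r * 0) 1 0 ⟨v, mem_expOp_domain_of_norm_lt_one (hdom hr) _⟩, fun z => rfl⟩ :
      ∃ R : Fock, ∀ z, R z = 1 * Complex.exp (0 * z) * v (r * z + r * 0))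
  have heq : ∀ r ∈ Set.Ioo (0 : ℝ) 1, ⟪(g : Fock), S r⟫_ℂ = conj ⟪(f : Fock), R r⟫_ℂ := by
    intro r hr
    have hpair : IsAdjointPair r (r * B) C D :=
      isAdjointPair_of_domain_eq_top (mem_expOp_domain_of_norm_lt_one (hdom hr))
    have hRg : ∀ z, R r z = conj C * Complex.exp (conj (r * B) * z) *
        (g : Fock) (conj (r : ℂ) * z + conj D) := by
      intro z
      rw [hR r hr, hv, expOp_apply]
      simp only [zero_mul, Complex.exp_zero, one_mul, mul_zero, add_zero, map_mul,
        Complex.conj_ofReal]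
      ring_nf
    have h1 := hpair ⟨f, mem_maxOp_domain_of_eq (hS r hr)⟩ ⟨g, mem_maxOp_domain_of_eq hRg⟩
    have h2 : expOp r (r * B) C D ⟨f, mem_maxOp_domain_of_eq (hS r hr)⟩ = S r := maxOp_eq (hS r hr)
    have h3 : expOp (conj (r : ℂ)) (conj D) (conj C) (conj (r * B))
      ⟨g, mem_maxOp_domain_of_eq hRg⟩ = R r := maxOp_eq hRg
    rw [h2, h3] at h1
    rw [← h1, inner_conj_symm]
  have t1 := tendsto_inner_dilate f S (by filter_upwards [hIoo] with r hr using hS r hr) g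
  -- Writing the identity as `expOp 1 0 1 0` lets the same weak limit lemma handle the dilates of
  -- `v`.
  have hv1 : v ∈ (expOp 1 0 1 0).domain := mem_maxOp_domain_of_eq (expOp_one_zero_one_zero v)
  have t2 := tendsto_inner_dilate ⟨v, hv1⟩ R (by filter_upwards [hIoo] with r hr using hR r hr) f
  have hv2 : expOp 1 0 1 0 ⟨v, hv1⟩ = v := maxOp_eq (expOp_one_zero_one_zero v)
  rw [hv2] at t2
  have t3 := (Complex.continuous_conj.tendsto _).comp t2
  have := tendsto_nhds_unique t1 (t3.congr' (by
    filter_upwards [hIoo] with r hr using (heq r hr).symm))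
  rw [← inner_conj_symm, this, Complex.conj_conj]

theorem Admissible.isAdjointPair (h : Admissible A B D) (hC : C ≠ 0) : IsAdjointPair A B C D := by
  rcases h with ⟨hA, hD⟩ | ⟨rfl, -⟩
  · rcases lt_trichotomy ‖A‖ 1 with h1 | h1 | h1
    · exact isAdjointPair_of_domain_eq_top (mem_expOp_domain_of_norm_lt_one h1)
    · refine isAdjointPair_of_domain_eq_top (mem_expOp_domain_of_norm_eq_one h1 ?_)
      have hAA : A * conj A = 1 := by rw [Complex.mul_conj', h1]; simp
      have h2 : 1 - conj A ≠ 0 := by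
        intro h
        apply hA
        rw [← hAA, ← sub_eq_zero.1 h, mul_one]
      rw [hD, mul_inv_eq_iff_eq_mul₀ h2]
      linear_combination (-conj B) * hAA
    · exact isAdjointPair_of_one_lt_norm h1 hC
  · exact isAdjointPair_one

/-- A cohyponormal restriction of `expOp A B C D` is the whole operator. -/
theorem Admissible.eq_of_isCohyponormal (h : Admissible A B D) (hC : C ≠ 0)
    {W : Fock →ₗ.[ℂ] Fock} (hW : W ≤ expOp A B C D) (hco : IsCohyponormal W) :
    W = expOp A B C D := by
  -- It is enough to place `f` in the domain of `W†`, where the adjoint-symbol operator supplies the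
  -- required vector.
  refine LinearPMap.eq_of_le_of_domain_eq hW (le_antisymm hW.1 fun f hf => hco.domain_le ?_)
  have hf' := h.mem_domain_iff.1 hf
  refine LinearPMap.mem_adjoint_domain_of_exists _
    ⟨expOp (conj A) (conj D) (conj C) (conj B) ⟨f, hf'⟩, fun g => ?_⟩
  rw [← inner_conj_symm, ← h.isAdjointPair hC ⟨g, hW.1 g.2⟩ ⟨f, hf'⟩, inner_conj_symm,
    hW.2 (x := g) (y := ⟨g, hW.1 g.2⟩) rfl]

end FockWCO

/-! ### From cohyponormality to the form of the symbols -/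

namespace FockWCO

open scoped LinearPMap

/-- An entire function without zeros has a holomorphic logarithm. -/
theorem exists_entire_log {ψ : ℂ → ℂ} (hψ : Differentiable ℂ ψ) (h0 : ∀ z, ψ z ≠ 0) :
    ∃ h : ℂ → ℂ, Differentiable ℂ h ∧ ∀ z, ψ z = Complex.exp (h z) := by
  have hd : Differentiable ℂ fun z => deriv ψ z / ψ z :=
    hψ.deriv.div hψ h0
  obtain ⟨g, hg0, hg⟩ := hd.isExactOn_univ.with_val_at 0 (Complex.log (ψ 0))
  have hgd : Differentiable ℂ g := fun z => (hg z trivial).differentiableAt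
  refine ⟨g, hgd, fun z => ?_⟩
  have hq : Differentiable ℂ fun z => ψ z * Complex.exp (-g z) := by fun_prop
  have hder : ∀ z, deriv (fun z => ψ z * Complex.exp (-g z)) z = 0 := by
    intro z
    have h1 := ((hψ z).hasDerivAt.mul ((hg z trivial).neg.cexp)).deriv
    refine Eq.trans h1 ?_
    have := h0 z
    field_simp
    ring
  have hc := is_const_of_deriv_eq_zero hq hder z 0
  simp only [hg0, Complex.exp_neg, Complex.exp_log (h0 0), mul_inv_cancel₀ (h0 0)] at hc
  rwa [mul_inv_eq_one₀ (Complex.exp_ne_zero _)] at hc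

/-- An entire function whose real part grows at most quadratically is a quadratic polynomial. -/
theorem eq_quadratic_of_re_le {g : ℂ → ℂ} (hg : Differentiable ℂ g) {M c : ℝ}
    (h : ∀ z, (g z).re ≤ M + c * ‖z‖ ^ 2) :
    ∃ α β γ : ℂ, ∀ z, g z = α * z ^ 2 + β * z + γ := by
  have hbound : ∀ r : ℝ, 1 ≤ r → ∀ z ∈ Metric.sphere (0 : ℂ) r,
      ‖g z‖ ≤ (2 * (|M| + |c| * 4 + 1) + 3 * ‖g 0‖) * r ^ 2 := by
    intro r hr z hz
    have hzr : ‖z‖ = r := by simpa using hz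
    have hr2 : 1 ≤ r ^ 2 := one_le_pow₀ hr
    -- The bound on the disc of radius `2 * r` controls `g` on the circle of radius `r`; the `+ 1`
    -- keeps the majorant positive.
    have h1 := Complex.borelCaratheodory (M := (|M| + |c| * 4 + 1) * r ^ 2) (R := 2 * r) (f := g)
      (z := z) (by positivity) hg.differentiableOn ?_ (by linarith) (by simp [hzr]; linarith)
    · rw [hzr, show 2 * r - r = r by ring, mul_div_assoc, mul_div_assoc, div_self (by linarith),
        mul_one, show 2 * r + r = 3 * r by ring, mul_div_assoc, div_self (by linarith)] at h1
      have : ‖g 0‖ * 1 ≤ ‖g 0‖ * r ^ 2 := by gcongr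
      linarith
    · intro x hx
      have hx' : ‖x‖ ≤ 2 * r := by simpa using (mem_ball_zero_iff.1 hx).le
      have h2 : ‖x‖ ^ 2 ≤ 4 * r ^ 2 := by nlinarith [norm_nonneg x]
      show (g x).re ≤ _
      calc (g x).re ≤ M + c * ‖x‖ ^ 2 := h x
        _ ≤ |M| * 1 + |c| * (4 * r ^ 2) := by
          rw [mul_one]
          gcongr
          · exact le_abs_self M
          · exact le_abs_self c
        _ ≤ |M| * r ^ 2 + |c| * (4 * r ^ 2) := by gcongr
        _ ≤ _ := by nlinarith
  set K := 2 * (|M| + |c| * 4 + 1) + 3 * ‖g 0‖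
  have hzero : ∀ n, 3 ≤ n → iteratedDeriv n g 0 = 0 := by
    intro n hn
    -- Two powers of `r` cancel the quadratic growth in the Cauchy estimate, and `m + 1 ≥ 1` powers
    -- remain to send it to zero.
    obtain ⟨m, rfl⟩ : ∃ m, n = m + 1 + 2 := ⟨n - 3, by omega⟩
    rw [← norm_le_zero_iff]
    have hlim : Tendsto (fun r : ℝ => ((m + 1 + 2).factorial * K) / r ^ (m + 1)) atTop (𝓝 0) :=
      tendsto_const_nhds.div_atTop (tendsto_pow_atTop (by omega))
    refine ge_of_tendsto hlim ?_
    filter_upwards [eventually_ge_atTop 1] with r hr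
    refine (Complex.norm_iteratedDeriv_le_of_forall_mem_sphere_norm_le (m + 1 + 2)
      (by linarith) hg.diffContOnCl (hbound r hr)).trans_eq ?_
    have : r ≠ 0 := by linarith
    rw [pow_add r (m + 1) 2]
    field_simp
  refine ⟨(2 : ℂ)⁻¹ * iteratedDeriv 2 g 0, iteratedDeriv 1 g 0, g 0, fun z => ?_⟩
  rw [← Complex.taylorSeries_eq_of_entire' 0 z hg, tsum_eq_sum (s := Finset.range 3)]
  · simp [Finset.sum_range_succ]
    ring
  · intro n hn
    rw [hzero n (by simpa using hn)]
    simp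

/-- Test on the line through a unit `u` with `α * u ^ 2 = ‖α‖`, and average the points `t * u` and
`-(t * u)` to remove the linear term. -/
theorem norm_le_of_re_quadratic_le {α β : ℂ} {M c : ℝ}
    (h : ∀ z : ℂ, (α * z ^ 2 + β * z).re ≤ M + c * ‖z‖ ^ 2) : ‖α‖ ≤ c := by
  obtain ⟨u, hu, hαu⟩ : ∃ u : ℂ, ‖u‖ = 1 ∧ α * u ^ 2 = ‖α‖ := by
    rcases eq_or_ne α 0 with rfl | hα
    · exact ⟨1, by simp, by simp⟩
    · obtain ⟨u, hu⟩ := IsAlgClosed.exists_pow_nat_eq ((‖α‖ : ℂ) / α) two_pos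
      refine ⟨u, ?_, by rw [hu]; field_simp⟩
      have h1 := congrArg norm hu
      rw [norm_pow, norm_div, Complex.norm_real, norm_norm, div_self (norm_ne_zero_iff.2 hα)] at h1
      exact (pow_eq_one_iff_of_nonneg (norm_nonneg u) two_ne_zero).1 h1
  have h1 : ∀ t : ℝ, t ^ 2 * (‖α‖ - c) ≤ M := by
    intro t
    have e1 := h (t * u)
    have e2 := h (-(t * u))
    have e3 : α * (t * u) ^ 2 = ((t ^ 2 * ‖α‖ : ℝ) : ℂ) := by
      push_cast
      rw [← hαu]; ring
    rw [neg_sq, norm_neg, mul_neg] at e2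
    rw [e3] at e1 e2
    simp only [norm_mul, hu, Complex.norm_real, Real.norm_eq_abs, mul_one, sq_abs, Complex.add_re,
      Complex.ofReal_re, Complex.neg_re] at e1 e2
    nlinarith
  by_contra! hlt
  have h2 := h1 √((|M| + 1) / (‖α‖ - c))
  have h3 : 0 < ‖α‖ - c := by linarith
  rw [Real.sq_sqrt (by positivity), div_mul_cancel₀ _ h3.ne'] at h2
  linarith [le_abs_self M]

theorem eq_zero_of_re_quadratic_le {α β : ℂ} {M : ℝ}
    (h : ∀ z : ℂ, (α * z ^ 2 + β * z).re ≤ M) : α = 0 ∧ β = 0 := by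
  have hα : α = 0 := norm_le_zero_iff.1
    (norm_le_of_re_quadratic_le (α := α) (β := β) (M := M) (c := 0) (by simpa using h))
  refine ⟨hα, ?_⟩
  by_contra hβ
  have h1 := h (((|M| + 1 : ℝ) : ℂ) / β)
  rw [hα, zero_mul, zero_add, mul_div_cancel₀ _ hβ, Complex.ofReal_re] at h1
  linarith [le_abs_self M]

/-- The inequality for kernel functions that cohyponormality implies. -/
theorem IsWeightedComp.norm_kernel_le {ψ φ : ℂ → ℂ} {W : Fock →ₗ.[ℂ] Fock}
    (hW : IsWeightedComp ψ φ W) (hco : IsCohyponormal W) (w z : ℂ) :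
    ‖ψ z * Complex.exp (conj w * φ z)‖ ≤
      Real.exp (‖z‖ ^ 2 / 2) * (‖ψ w‖ * Real.exp (‖φ w‖ ^ 2 / 2)) := by
  have h1 := hco.norm_le ⟨kernel w, hW.kernel_mem_adjoint_domain w⟩
  rw [hW.adjoint_kernel hco.dense, norm_smul, RCLike.norm_conj, norm_kernel] at h1
  refine le_trans ?_ (mul_le_mul_of_nonneg_left h1 (Real.exp_pos _).le)
  refine le_trans (le_of_eq ?_) (Fock.norm_apply_le_exp _ z)
  rw [hW.apply, kernel_apply]

/-- Taking `w = 0` and `w = 1` shows that `h` and `h + φ` are quadratic. Letting `w` vary then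
bounds the leading coefficient of `h + conj w * φ`, so `φ` has no quadratic term. -/
theorem quadratic_symbols {h φ : ℂ → ℂ} (hh : Differentiable ℂ h) (hφ : Differentiable ℂ φ)
    (H : ∀ w z, (h z + conj w * φ z).re ≤ ‖z‖ ^ 2 / 2 + (h w).re + ‖φ w‖ ^ 2 / 2) :
    ∃ a D E A B : ℂ, (∀ z, h z = a * z ^ 2 + D * z + E) ∧ ∀ z, φ z = A * z + B := by
  obtain ⟨a, D, E, h1⟩ := eq_quadratic_of_re_le (M := (h 0).re + ‖φ 0‖ ^ 2 / 2) (c := 1 / 2) hh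
    fun z => by have := H 0 z; simp only [map_zero, zero_mul, add_zero] at this; linarith
  obtain ⟨a', D', E', h2⟩ := eq_quadratic_of_re_le (M := (h 1).re + ‖φ 1‖ ^ 2 / 2) (c := 1 / 2)
    (hh.add hφ) fun z => by
      have := H 1 z
      simp only [map_one, one_mul] at this
      simp only [Pi.add_apply]
      linarith
  have h3 : ∀ z, φ z = (a' - a) * z ^ 2 + (D' - D) * z + (E' - E) := fun z => by
    have := h2 z
    simp only [Pi.add_apply, h1 z] at this
    linear_combination this
  have hb : a' - a = 0 := by
    set b := a' - a with hb
    have h4 : ∀ w : ℂ, ‖a + conj w * b‖ ≤ 1 / 2 := by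
      intro w
      refine norm_le_of_re_quadratic_le (β := D + conj w * (D' - D))
        (M := (h w).re + ‖φ w‖ ^ 2 / 2 - (E + conj w * (E' - E)).re) fun z => ?_
      have := H w z
      rw [h1 z, h3 z] at this
      have e : a * z ^ 2 + D * z + E + conj w * (b * z ^ 2 + (D' - D) * z + (E' - E)) =
        (a + conj w * b) * z ^ 2 + (D + conj w * (D' - D)) * z + (E + conj w * (E' - E)) := by ring
      rw [e, Complex.add_re] at this
      linarith
    by_contra hb0
    -- This `w` makes `a + conj w * b = 1`, above the bound `1 / 2`.
    have h5 := h4 (conj ((1 - a) / b))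
    rw [Complex.conj_conj, div_mul_cancel₀ _ hb0, add_sub_cancel, norm_one] at h5
    linarith
  exact ⟨a, D, E, D' - D, E' - E, h1, fun z => by rw [h3, hb]; ring⟩

theorem admissible_of_kernel_inequality {a D E A B : ℂ}
    (H : ∀ w z : ℂ, (a * z ^ 2 + D * z + E + conj w * (A * z + B)).re ≤
      ‖z‖ ^ 2 / 2 + (a * w ^ 2 + D * w + E).re + ‖A * w + B‖ ^ 2 / 2) :
    a = 0 ∧ Admissible A B D := by
  -- At `z = conj A * w + δ` the terms in `‖w‖²` cancel, and so do the cross terms of `δ` with `conj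
  -- w`. The left side is then the real part of a polynomial in `w`, and the right side does not
  -- involve `w`.
  have key : ∀ δ w : ℂ, (a * (conj A ^ 2 - 1) * w ^ 2 +
      (2 * a * conj A * δ + (D * (conj A - 1) + conj B * (1 - A))) * w).re ≤
      ‖δ‖ ^ 2 / 2 + ‖B‖ ^ 2 / 2 - (a * δ ^ 2 + D * δ).re := by
    intro δ w
    have := H w (conj A * w + δ)
    rw [Complex.sq_norm, Complex.sq_norm, Complex.normSq_apply, Complex.normSq_apply] at this ⊢
    simp only [Complex.add_re, Complex.add_im, Complex.mul_re, Complex.mul_im, Complex.conj_re, Complex.conj_im, pow_two, Complex.sub_re,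
      Complex.sub_im, Complex.one_re, Complex.one_im, Complex.re_ofNat, Complex.im_ofNat] at this ⊢
    linarith
  have h0 := fun δ => eq_zero_of_re_quadratic_le (key δ)
  have e1 := (h0 0).1
  have e2 := (h0 0).2
  have e3 := (h0 1).2
  -- The linear coefficient vanishes for `δ = 0` and `δ = 1`, so `2 * a * conj A = 0`; with `a *
  -- (conj A ^ 2 - 1) = 0` this leaves `a = 0`.
  have ha : a = 0 := by linear_combination conj A / 2 * (e3 - e2) - e1
  have hD : D * (1 - conj A) = conj B * (1 - A) := by linear_combination -e2
  refine ⟨ha, ?_⟩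
  by_cases hA : A = 1
  · right
    refine ⟨hA, ?_⟩
    -- The choice `δ = conj D` maximises `(D * δ).re - ‖δ‖² / 2`, giving the sharp bound.
    have h1 := key (conj D) 0
    simp only [ha, zero_mul, mul_zero, add_zero, zero_add, Complex.zero_re, Complex.mul_conj',
      RCLike.norm_conj] at h1
    rw [← Complex.ofReal_pow, Complex.ofReal_re] at h1
    refine (sq_le_sq₀ (norm_nonneg _) (norm_nonneg _)).1 ?_
    linarith
  · left
    refine ⟨hA, ?_⟩
    have h2 : 1 - conj A ≠ 0 := by
      intro h
      apply hA
      have := congrArg conj (sub_eq_zero.1 h)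
      simpa using this.symm
    rw [← hD, mul_inv_cancel_right₀ h2]

theorem exists_admissible {ψ φ : ℂ → ℂ} (hψ : Differentiable ℂ ψ) (hφ : Differentiable ℂ φ)
    (hψ0 : ψ ≠ 0) {W : Fock →ₗ.[ℂ] Fock} (hW : IsWeightedComp ψ φ W) (hco : IsCohyponormal W) :
    ∃ A B C D : ℂ, C ≠ 0 ∧ Admissible A B D ∧ φ = (fun z => A * z + B) ∧
      ψ = fun z => C * Complex.exp (D * z) := by
  have hk := hW.norm_kernel_le hco
  have hne : ∀ w, ψ w ≠ 0 := by
    intro w hw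
    refine hψ0 (funext fun z => ?_)
    have := hk w z
    rw [hw, norm_zero, zero_mul, mul_zero, norm_le_zero_iff] at this
    exact (mul_eq_zero.1 this).resolve_right (Complex.exp_ne_zero _)
  obtain ⟨h, hh, hexp⟩ := exists_entire_log hψ hne
  have H : ∀ w z, (h z + conj w * φ z).re ≤ ‖z‖ ^ 2 / 2 + (h w).re + ‖φ w‖ ^ 2 / 2 := by
    intro w z
    have := hk w z
    rw [hexp z, hexp w, ← Complex.exp_add, Complex.norm_exp, Complex.norm_exp, ← Real.exp_add,
      ← Real.exp_add, Real.exp_le_exp] at this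
    linarith
  obtain ⟨a, D, E, A, B, h1, h2⟩ := quadratic_symbols hh hφ H
  obtain ⟨rfl, hadm⟩ := admissible_of_kernel_inequality (a := a) (D := D) (E := E) (A := A) (B := B)
    fun w z => by simpa only [h1, h2] using H w z
  refine ⟨A, B, Complex.exp E, D, Complex.exp_ne_zero _, hadm, funext h2, funext fun z => ?_⟩
  rw [hexp, h1, ← Complex.exp_add]
  ring_nf

end FockWCO

theorem theorem6p6 (ψ φ : ℂ → ℂ) (hψ : Differentiable ℂ ψ) (hφ : Differentiable ℂ φ)
    (hψ0 : ψ ≠ 0) (W : FockWCO.Fock →ₗ.[ℂ] FockWCO.Fock)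
    (hW : FockWCO.IsWeightedComp ψ φ W) :
    FockWCO.IsCohyponormal W ↔
      W = FockWCO.maxOp ψ φ ∧
        ((∃ A B C D : ℂ, A ≠ 1 ∧ (∀ z, φ z = A * z + B) ∧
            (∀ z, ψ z = C * Complex.exp (D * z)) ∧
            D = conj B * (1 - A) * (1 - conj A)⁻¹) ∨
          (∃ B C D : ℂ, (∀ z, φ z = z + B) ∧
            (∀ z, ψ z = C * Complex.exp (D * z)) ∧ ‖D‖ ≤ ‖B‖)) := by
  constructor
  · intro hco
    obtain ⟨A, B, C, D, hC, hadm, rfl, rfl⟩ := FockWCO.exists_admissible hψ hφ hψ0 hW hco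
    refine ⟨FockWCO.Admissible.eq_of_isCohyponormal hadm hC hW hco, ?_⟩
    rcases hadm with ⟨hA, hD⟩ | ⟨rfl, hD⟩
    · exact Or.inl ⟨A, B, C, D, hA, fun _ => rfl, fun _ => rfl, hD⟩
    · exact Or.inr ⟨B, C, D, fun z => by simp only [one_mul], fun _ => rfl, hD⟩
  · rintro ⟨rfl, ⟨A, B, C, D, hA, h1, h2, hD⟩ | ⟨B, C, D, h1, h2, hD⟩⟩
    · obtain rfl := funext h1
      obtain rfl := funext h2
      exact FockWCO.Admissible.isCohyponormal (Or.inl ⟨hA, hD⟩)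
    · obtain rfl : φ = fun z => 1 * z + B := funext fun z => by rw [h1, one_mul]
      obtain rfl := funext h2
      exact FockWCO.Admissible.isCohyponormal (Or.inr ⟨rfl, hD⟩)
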